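/- Let $M$ be a smooth manifold (finite-dimensional, Hausdorff, second countable, without boundary) and let $E\to M$ be a smooth complex vector bundle of finite rank. Write $\mathcal A=C^\infty(M)$ for the $*$-algebra of complex-valued smooth functions and $\mathcal E=\Gamma^\infty(E)$ for the (right) $\mathcal A$-module of smooth sections. Let $\star$ be a formal deformation of $\mathcal A$, that is, an associative $\mathbb C[[\lambda]]$-bilinear product on $\mathcal A[[\lambda]]$ of the form $f\star g=\sum_{r\ge 0}C_r(f,g)\lambda^r$ with $\mathbb C$-bilinear $C_r:\mathcal A\times\mathcal A\to\mathcal A$, $C_0(f,g)=fg$, and with unit $1$; put $\boldsymbol{\mathcal A}=(\mathcal A[[\lambda]],\star)$. (For instance, $\star$ may be a star product quantizing a Poisson structure on $M$; no relation of $\star$ to a prescribed Poisson bracket is needed.) The deformation is Hermitian if $\overline{f\star g}=\overline g\star\overline f$. A deformation quantization of $E$ corresponding to $\boldsymbol{\mathcal A}$ is a right $\boldsymbol{\mathcal A}$-module structure on $\mathcal E[[\lambda]]$ of the form $s\bullet f=\sum_{r\ge0}R_r(s,f)\lambda^r$ with $\mathbb C$-bilinear $R_r:\mathcal E\times\mathcal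 A\to\mathcal E$ and $R_0(s,f)=sf$. Two of them, $\bullet$ and $\bullet'$, are equivalent if there is an isomorphism of $\boldsymbol{\mathcal A}$-modules $(\mathcal E[[\lambda]],\bullet)\to(\mathcal E[[\lambda]],\bullet')$ of the form $\boldsymbol T=\mathrm{id}+\sum_{r\ge1}T_r\lambda^r$ with $\mathbb C$-linear $T_r:\mathcal E\to\mathcal E$. If $\star$ is Hermitian and $h_0$ is a smooth Hermitian fiber metric on $E$ (conjugate-linear in the first argument), a Hermitian deformation quantization of $(E,h_0)$ is a deformation quantization $\bullet$ of $E$ together with $\boldsymbol h=\sum_{r\ge0}h_r\lambda^r$, where the $h_r:\mathcal E\times\mathcal E\to\mathcal A$ for $r\ge 1$ are conjugate-linear in the first and linear in the second argument, such that $\boldsymbol h$ on $\mathcal E[[\lambda]]$ satisfies $\overline{\boldsymbol h(x,y)}=\boldsymbol h(y,x)$ and $\boldsymbol h(x,y\bullet f)=\boldsymbol h(x,y)\star f$, $\boldsymbol h(x,x)$ is a positive element of $\boldsymbol{\mathcal A}$, and $\boldsymbol h(x,x)=0$ only for $x=0$. Here $a\in\boldsymbol{\mathcal A}$ is positive if $\omega(a)\ge0$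 for every $\mathbb C[[\lambda]]$-linear $\omega:\boldsymbol{\mathcal A}\to\mathbb C[[\lambda]]$ with $\omega(\overline b\star b)\ge0$ for all $b\in\boldsymbol{\mathcal A}$, where $z\geq 0$ means that $z\in\mathbb R[[\lambda]]$ and $z$ is $0$ or has positive lowest non-vanishing coefficient. Two Hermitian deformation quantizations are isometrically equivalent if there is an equivalence $\boldsymbol T$ as above with $\boldsymbol h'(\boldsymbol Tx,\boldsymbol Ty)=\boldsymbol h(x,y)$. A sequence of such maps $B_r$ of two arguments ($C_r$, $R_r$ or $h_r$) is called local if $\operatorname{supp}B_r(x,y)\subseteq\operatorname{supp}x\cap\operatorname{supp}y$ for all $r$; differential if each $B_r$ is a differential operator of some finite order in each argument; and of Vey type if each $B_r$ is a differential operator of order at most $r$ in each argument. The deformation $\star$ has one of these types if $(C_r)$ has it; a deformation quantization of $E$ has it if $(R_r)$ has it; a Hermitian one has it if $(R_r)$ and $(h_r)$ have it. Theorem. 1. There exists a deformation quantization of $E$ corresponding to $\boldsymbol{\mathcal A}$, and any two are equivalent. If $\star$ is local (respectively differential, of Vey type), there is one that is local (respectively differential, of Vey type). 2. If $\star$ is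 Hermitian and $h_0$ is a Hermitian fiber metric on $E$, there exists a Hermitian deformation quantization of $(E,h_0)$ corresponding to $\boldsymbol{\mathcal A}$, and any two are isometrically equivalent. If moreover $\star$ is local (respectively differential, of Vey type), there is a Hermitian one that is local (respectively differential, of Vey type). -/

import Mathlib

open Bundle
open scoped Manifold ContDiff

noncomputable section

/-! ### Formal power series

A formal power series `∑ xᵣ λʳ` with coefficients in `X` is its sequence of coefficients
`x : ℕ → X`; sums and (for `X` with an involution) the involution are coefficientwise. -/

/-- The `λ`-bilinear extension to formal power series of `∑ Bᵣ λʳ`, where each `Bᵣ` is a map of two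
variables: the coefficient of `λⁿ` is the sum of all `Bᵣ(xᵢ, yⱼ)` with `r + i + j = n`. -/
def formalBilin {X Y Z : Type*} [AddCommMonoid Z] (B : ℕ → X → Y → Z) (x : ℕ → X) (y : ℕ → Y) :
    ℕ → Z :=
  fun n => ∑ p ∈ Finset.HasAntidiagonal.antidiagonal n,
    ∑ q ∈ Finset.HasAntidiagonal.antidiagonal p.2, B p.1 (x q.1) (y q.2)

/-- The `λ`-linear extension to formal power series of `∑ Tᵣ λʳ`: the coefficient of `λⁿ` is the
sum of all `Tᵣ(xᵢ)` with `r + i = n`. -/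
def formalLin {X Y : Type*} [AddCommMonoid Y] (T : ℕ → X → Y) (x : ℕ → X) : ℕ → Y :=
  fun n => ∑ p ∈ Finset.HasAntidiagonal.antidiagonal n, T p.1 (x p.2)

/-- The constant formal power series. -/
def formalConst {X : Type*} [Zero X] (a : X) : ℕ → X := Pi.single 0 a

/-- `z ≥ 0` for `z ∈ ℂ[[λ]]`: all coefficients are real, and `z = 0` or the first non-vanishing
coefficient is positive (the order of `ℝ[[λ]]`). -/
def FormalNonneg (z : ℕ → ℂ) : Prop :=
  (∀ n, (z n).im = 0) ∧ (z = 0 ∨ ∃ n, (∀ m < n, z m = 0) ∧ 0 < (z n).re)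

/-! ### Formal deformations of algebras -/

/-- A formal deformation of the commutative unital `k`-algebra `A`: an associative
`k[[λ]]`-bilinear product `a ⋆ b = ∑ Cᵣ(a, b) λʳ` on `A[[λ]]` with `C₀` the product of `A`, whose
unit is the unit of `A`. -/
structure FormalDeformation (k A : Type*) [CommRing k] [CommRing A] [Algebra k A] where
  C : ℕ → A →ₗ[k] A →ₗ[k] A
  C_zero : ∀ a b, C 0 a b = a * b
  assoc : ∀ a b c : ℕ → A,
    formalBilin (fun r x y => C r x y) (formalBilin (fun r x y => C r x y) a b) c =
      formalBilin (fun r x y => C r x y) a (formalBilin (fun r x y => C r x y) b c)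
  one_left : ∀ a : ℕ → A, formalBilin (fun r x y => C r x y) (formalConst 1) a = a
  one_right : ∀ a : ℕ → A, formalBilin (fun r x y => C r x y) a (formalConst 1) = a

namespace FormalDeformation

/-- The deformed product on `A[[λ]]`. -/
def mul {k A : Type*} [CommRing k] [CommRing A] [Algebra k A] (S : FormalDeformation k A)
    (a b : ℕ → A) : ℕ → A :=
  formalBilin (fun r x y => S.C r x y) a b

/-- The deformation is Hermitian: the involution of `A` is an involution for the deformed
product. -/
def IsHermitian {A : Type*} [CommRing A] [Algebra ℂ A] [StarRing A]
    (S : FormalDeformation ℂ A) : Prop :=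
  ∀ a b : ℕ → A, star (S.mul a b) = S.mul (star b) (star a)

/-- The `ℂ[[λ]]`-linear functional `φ = ∑ φᵣ λʳ : A[[λ]] → ℂ[[λ]]` is positive:
`φ(a* ⋆ a) ≥ 0` for all `a ∈ A[[λ]]`. -/
def IsPositiveFunctional {A : Type*} [CommRing A] [Algebra ℂ A] [StarRing A]
    (S : FormalDeformation ℂ A) (φ : ℕ → A →ₗ[ℂ] ℂ) : Prop :=
  ∀ a : ℕ → A, FormalNonneg (formalLin (fun r x => φ r x) (S.mul (star a) a))

/-- `a ∈ A[[λ]]` is a positive element of the deformed algebra: `φ(a) ≥ 0` for all positive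
`ℂ[[λ]]`-linear functionals `φ`. -/
def IsPositive {A : Type*} [CommRing A] [Algebra ℂ A] [StarRing A]
    (S : FormalDeformation ℂ A) (a : ℕ → A) : Prop :=
  ∀ φ : ℕ → A →ₗ[ℂ] ℂ, S.IsPositiveFunctional φ → FormalNonneg (formalLin (fun r x => φ r x) a)

end FormalDeformation

/-! ### Deformations of modules -/

/-- A deformation of the `A`-module `E`, considered as a right module, corresponding to the
deformed algebra `(A[[λ]], ⋆)`: a right module structure `x • a = ∑ Rᵣ(x, a) λʳ` on `E[[λ]]` over
the deformed algebra, with `R₀` the given action. -/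
structure ModuleDeformation {k A : Type*} [CommRing k] [CommRing A] [Algebra k A]
    (S : FormalDeformation k A) (E : Type*) [AddCommGroup E] [Module k E] [Module A E] where
  R : ℕ → E →ₗ[k] A →ₗ[k] E
  R_zero : ∀ x a, R 0 x a = a • x
  act_mul : ∀ (x : ℕ → E) (a b : ℕ → A),
    formalBilin (fun r x a => R r x a) (formalBilin (fun r x a => R r x a) x a) b =
      formalBilin (fun r x a => R r x a) x (S.mul a b)
  act_one : ∀ x : ℕ → E, formalBilin (fun r x a => R r x a) x (formalConst 1) = x

namespace ModuleDeformation

variable {k A : Type*} [CommRing k] [CommRing A] [Algebra k A] {S : FormalDeformation k A}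
  {E : Type*} [AddCommGroup E] [Module k E] [Module A E]

/-- The deformed right action of `(A[[λ]], ⋆)` on `E[[λ]]`. -/
def act (D : ModuleDeformation S E) (x : ℕ → E) (a : ℕ → A) : ℕ → E :=
  formalBilin (fun r x a => D.R r x a) x a

/-- `id + ∑_{r ≥ 1} Tᵣ λʳ` is an isomorphism of right modules over the deformed algebra. -/
structure IsEquivalence (D D' : ModuleDeformation S E) (T : ℕ → E →ₗ[k] E) : Prop where
  T_zero : T 0 = LinearMap.id
  bijective : Function.Bijective (formalLin (fun r x => T r x))
  map_act : ∀ (x : ℕ → E) (a : ℕ → A),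
    formalLin (fun r x => T r x) (D.act x a) = D'.act (formalLin (fun r x => T r x) x) a

/-- Equivalence of two deformations of a module. -/
def Equivalent (D D' : ModuleDeformation S E) : Prop :=
  ∃ T : ℕ → E →ₗ[k] E, D.IsEquivalence D' T

end ModuleDeformation

/-- A Hermitian deformation of the inner-product module `(E, h₀)`: a deformation of the module `E`
with a positive definite inner product `h = ∑ hᵣ λʳ` on `E[[λ]]` with values in the deformed
algebra, right linear over it, and with `h₀` as its lowest order. -/
structure HermitianModuleDeformation {A : Type*} [CommRing A] [Algebra ℂ A] [StarRing A]
    (S : FormalDeformation ℂ A) {E : Type*} [AddCommGroup E] [Module ℂ E] [Module A E]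
    (h₀ : E →ₗ⋆[ℂ] E →ₗ[ℂ] A) extends ModuleDeformation S E where
  h : ℕ → E →ₗ⋆[ℂ] E →ₗ[ℂ] A
  h_zero : h 0 = h₀
  h_star : ∀ x y : ℕ → E,
    star (formalBilin (fun r x y => h r x y) x y) = formalBilin (fun r x y => h r x y) y x
  h_act : ∀ (x y : ℕ → E) (a : ℕ → A),
    formalBilin (fun r x y => h r x y) x (toModuleDeformation.act y a) =
      S.mul (formalBilin (fun r x y => h r x y) x y) a
  h_pos : ∀ x : ℕ → E, S.IsPositive (formalBilin (fun r x y => h r x y) x x)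
  h_definite : ∀ x : ℕ → E, formalBilin (fun r x y => h r x y) x x = 0 → x = 0

namespace HermitianModuleDeformation

variable {A : Type*} [CommRing A] [Algebra ℂ A] [StarRing A] {S : FormalDeformation ℂ A}
  {E : Type*} [AddCommGroup E] [Module ℂ E] [Module A E] {h₀ : E →ₗ⋆[ℂ] E →ₗ[ℂ] A}

/-- The deformed inner product on `E[[λ]]`. -/
def inner (D : HermitianModuleDeformation S h₀) (x y : ℕ → E) : ℕ → A :=
  formalBilin (fun r x y => D.h r x y) x y

/-- Isometric equivalence of two Hermitian deformations. -/
def Equivalent (D D' : HermitianModuleDeformation S h₀) : Prop :=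
  ∃ T : ℕ → E →ₗ[ℂ] E, D.toModuleDeformation.IsEquivalence D'.toModuleDeformation T ∧
    ∀ x y : ℕ → E,
      D'.inner (formalLin (fun r x => T r x) x) (formalLin (fun r x => T r x) y) = D.inner x y

end HermitianModuleDeformation

/-! ### Differential operators -/

/-- An additive map `D : E → F` between modules over the commutative ring `A` is a differential
operator of order at most `k`: its `(k+1)`-fold iterated commutators with multiplications by
elements of `A` vanish. For smooth sections of vector bundles over the smooth functions, these are
the usual differential operators of order at most `k`. -/
def IsDiffOp (A : Type*) [CommRing A] {E F : Type*} [AddCommGroup E] [AddCommGroup F] [Module A E]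
    [Module A F] : ℕ → (E → F) → Prop
  | 0, D => ∀ (a : A) (x : E), D (a • x) = a • D x
  | k + 1, D => ∀ a : A, IsDiffOp A k (fun x => D (a • x) - a • D x)

/-- A bilinear map that is differential of order at most `k` in each argument. -/
def IsBidiff (A : Type*) [CommRing A] {E F G : Type*} [AddCommGroup E] [AddCommGroup F]
    [AddCommGroup G] [Module A E] [Module A F] [Module A G] (k : ℕ) (B : E → F → G) : Prop :=
  (∀ y, IsDiffOp A k (fun x => B x y)) ∧ ∀ x, IsDiffOp A k (fun y => B x y)

/-- A map, conjugate-linear in its first and linear in its second argument, that is differential of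
order at most `k` in each argument; the first argument is made linear by the involution of `A`. -/
def IsSesquiDiff (A : Type*) [CommRing A] [StarRing A] {E : Type*} [AddCommGroup E] [Module A E]
    (k : ℕ) (h : E → E → A) : Prop :=
  (∀ y, IsDiffOp A k (fun x => star (h x y))) ∧ ∀ x, IsDiffOp A k (fun y => h x y)

/-- The types of deformations that are considered. -/
inductive DeformationType
  | isLocal
  | differential
  | vey

/-! ### Complex vector bundles over real manifolds -/

/-- A complex vector bundle is in particular a real vector bundle. -/
instance complexVectorBundle_toReal {M : Type*} [TopologicalSpace M] {F : Type*}
    [NormedAddCommGroup F] [NormedSpace ℂ F] {V : M → Type*} [TopologicalSpace (TotalSpace F V)]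
    [∀ p, AddCommGroup (V p)] [∀ p, Module ℂ (V p)] [∀ p, TopologicalSpace (V p)]
    [FiberBundle F V] [VectorBundle ℂ F V] : VectorBundle ℝ F V where
  trivialization_linear' e he :=
    ⟨fun b hb =>
      { map_add := (e.linear ℂ hb).map_add
        map_smul := fun c x => (e.linear ℂ hb).map_smul (c : ℂ) x }⟩
  continuousOn_coordChange' e e' he he' := by
    have h := (ContinuousLinearMap.restrictScalarsL ℂ F F ℝ ℝ).continuous.comp_continuousOn
      (continuousOn_coordChange ℂ e e')
    refine h.congr fun b hb => ?_
    have : e.IsLinear ℝ := ⟨fun b hb =>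
      { map_add := (e.linear ℂ hb).map_add
        map_smul := fun c x => (e.linear ℂ hb).map_smul (c : ℂ) x }⟩
    have : e'.IsLinear ℝ := ⟨fun b hb =>
      { map_add := (e'.linear ℂ hb).map_add
        map_smul := fun c x => (e'.linear ℂ hb).map_smul (c : ℂ) x }⟩
    ext v
    exact (e.coordChangeL_apply (R := ℝ) e' hb v).trans (e.coordChangeL_apply (R := ℂ) e' hb v).symm

/-- The `*`-algebra `C^∞(M)` of complex-valued smooth functions on the manifold `M`, with pointwise
operations and complex conjugation. -/
def smoothFunctions (d : ℕ) (M : Type*) [TopologicalSpace M]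
    [ChartedSpace (EuclideanSpace ℝ (Fin d)) M] : StarSubalgebra ℂ (M → ℂ) where
  carrier := {f | ContMDiff (𝓡 d) 𝓘(ℝ, ℂ) ∞ f}
  mul_mem' hf hg := (contDiff_mul (𝕜 := ℝ)).contMDiff.comp (hf.prodMk_space hg)
  add_mem' hf hg := ContMDiff.add hf hg
  algebraMap_mem' _ := contMDiff_const
  star_mem' hf := (Complex.conjCLE : ℂ →L[ℝ] ℂ).contMDiff.comp hf

section Sections

variable (d : ℕ) {M : Type*} [TopologicalSpace M] [ChartedSpace (EuclideanSpace ℝ (Fin d)) M]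
  (F : Type*) [NormedAddCommGroup F] [NormedSpace ℂ F] (V : M → Type*)
  [TopologicalSpace (TotalSpace F V)] [∀ p, AddCommGroup (V p)] [∀ p, Module ℂ (V p)]
  [∀ p, TopologicalSpace (V p)] [FiberBundle F V] [VectorBundle ℂ F V]

variable {d F V} in
theorem contMDiff_complex_smul_section {f : M → ℂ} {s : ∀ p, V p}
    (hf : ContMDiff (𝓡 d) 𝓘(ℝ, ℂ) ∞ f)
    (hs : ContMDiff (𝓡 d) ((𝓡 d).prod 𝓘(ℝ, F)) ∞ fun p => TotalSpace.mk' F p (s p)) :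
    ContMDiff (𝓡 d) ((𝓡 d).prod 𝓘(ℝ, F)) ∞ fun p => TotalSpace.mk' F p (f p • s p) := by
  intro p₀
  have hs' := hs p₀
  rw [contMDiffAt_section] at hs' ⊢
  refine ((ContinuousLinearMap.lsmul ℝ ℂ (E := F)).isBoundedBilinearMap.contDiff.contMDiff.contMDiffAt.comp
    p₀ ((hf p₀).prodMk_space hs')).congr_of_eventuallyEq ?_
  filter_upwards [(trivializationAt F V p₀).open_baseSet.mem_nhds
    (mem_baseSet_trivializationAt F V p₀)] with p hp
  exact ((trivializationAt F V p₀).linear ℂ hp).2 (f p) (s p)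

/-- The complex vector space `Γ^∞(V)` of smooth sections of a complex vector bundle over a
manifold. -/
def smoothSections : Submodule ℂ (∀ p, V p) where
  carrier := {s | ContMDiff (𝓡 d) ((𝓡 d).prod 𝓘(ℝ, F)) ∞ fun p => TotalSpace.mk' F p (s p)}
  add_mem' hs ht := ContMDiff.add_section hs ht
  zero_mem' := contMDiff_zeroSection ℝ V
  smul_mem' c _ hs := contMDiff_complex_smul_section (f := fun _ => c) contMDiff_const hs

/-- `Γ^∞(V)` is a module over `C^∞(M)` by pointwise multiplication. -/
instance smoothSectionsModule : Module (smoothFunctions d M) (smoothSections d F V) where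
  smul f s := ⟨fun p => f.1 p • s.1 p, contMDiff_complex_smul_section f.2 s.2⟩
  one_smul _ := Subtype.ext (funext fun _ => one_smul _ _)
  mul_smul _ _ _ := Subtype.ext (funext fun _ => mul_smul _ _ _)
  smul_zero _ := Subtype.ext (funext fun _ => smul_zero _)
  smul_add _ _ _ := Subtype.ext (funext fun _ => smul_add _ _ _)
  add_smul _ _ _ := Subtype.ext (funext fun _ => add_smul _ _ _)
  zero_smul _ := Subtype.ext (funext fun _ => zero_smul _ _)

/-- A Hermitian fiber metric on a complex vector bundle: a positive definite Hermitian form on each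
fiber, conjugate-linear in the first argument, which depends smoothly on the base point. -/
structure HermitianMetric where
  form : ∀ p, V p →ₗ⋆[ℂ] V p →ₗ[ℂ] ℂ
  conj_symm : ∀ p v w, star (form p v w) = form p w v
  pos : ∀ p v, v ≠ 0 → 0 < (form p v v).re
  smooth : ∀ s t : smoothSections d F V,
    ContMDiff (𝓡 d) 𝓘(ℝ, ℂ) ∞ fun p => form p (s.1 p) (t.1 p)

variable {d F V}

/-- The `C^∞(M)`-valued inner product on `Γ^∞(V)` defined by a Hermitian fiber metric. -/
def HermitianMetric.onSections (g : HermitianMetric d F V) :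
    smoothSections d F V →ₗ⋆[ℂ] smoothSections d F V →ₗ[ℂ] smoothFunctions d M :=
  LinearMap.mk₂'ₛₗ (starRingEnd ℂ) (RingHom.id ℂ)
    (fun s t => ⟨fun p => g.form p (s.1 p) (t.1 p), g.smooth s t⟩)
    (fun s s' t => Subtype.ext (funext fun p =>
      LinearMap.map_add₂ (g.form p) (s.1 p) (s'.1 p) (t.1 p)))
    (fun c s t => Subtype.ext (funext fun p =>
      LinearMap.map_smulₛₗ₂ (g.form p) c (s.1 p) (t.1 p)))
    (fun s t t' => Subtype.ext (funext fun p => map_add (g.form p (s.1 p)) (t.1 p) (t'.1 p)))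
    (fun c s t => Subtype.ext (funext fun p => map_smul (g.form p (s.1 p)) c (t.1 p)))

end Sections

/-! ### Local deformations, differential deformations and deformations of Vey type -/

/-- The support of a section of a family of pointed sets; functions are the case of a constant
family. -/
def sectionSupport {M : Type*} [TopologicalSpace M] {W : M → Type*} [∀ p, Zero (W p)]
    (s : ∀ p, W p) : Set M :=
  closure {p | s p ≠ 0}

section Types

variable {d : ℕ} {M : Type*} [TopologicalSpace M] [ChartedSpace (EuclideanSpace ℝ (Fin d)) M]
  {F : Type*} [NormedAddCommGroup F] [NormedSpace ℂ F] {V : M → Type*}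
  [TopologicalSpace (TotalSpace F V)] [∀ p, AddCommGroup (V p)] [∀ p, Module ℂ (V p)]
  [∀ p, TopologicalSpace (V p)] [FiberBundle F V] [VectorBundle ℂ F V]

/-- The star product is local (each `Cᵣ` is local), differential (each `Cᵣ` is bidifferential), or
of Vey type (each `Cᵣ` is differential of order at most `r` in each argument). -/
def FormalDeformation.HasType (S : FormalDeformation ℂ (smoothFunctions d M)) :
    DeformationType → Prop
  | .isLocal => ∀ r a b, sectionSupport (S.C r a b).1 ⊆ sectionSupport a.1 ∩ sectionSupport b.1
  | .differential => ∀ r, ∃ k, IsBidiff (smoothFunctions d M) k fun a b => S.C r a b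
  | .vey => ∀ r, IsBidiff (smoothFunctions d M) r fun a b => S.C r a b

/-- The same types for the deformed module structure on `Γ^∞(V)[[λ]]`. -/
def ModuleDeformation.HasType {S : FormalDeformation ℂ (smoothFunctions d M)}
    (D : ModuleDeformation S (smoothSections d F V)) : DeformationType → Prop
  | .isLocal => ∀ r x a, sectionSupport (D.R r x a).1 ⊆ sectionSupport x.1 ∩ sectionSupport a.1
  | .differential => ∀ r, ∃ k, IsBidiff (smoothFunctions d M) k fun x a => D.R r x a
  | .vey => ∀ r, IsBidiff (smoothFunctions d M) r fun x a => D.R r x a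

/-- The same types for a Hermitian deformation: both the module structure and the inner product
have the type. -/
def HermitianModuleDeformation.HasType {S : FormalDeformation ℂ (smoothFunctions d M)}
    {h₀ : smoothSections d F V →ₗ⋆[ℂ] smoothSections d F V →ₗ[ℂ] smoothFunctions d M}
    (D : HermitianModuleDeformation S h₀) (τ : DeformationType) : Prop :=
  D.toModuleDeformation.HasType τ ∧
    match τ with
    | .isLocal =>
        ∀ r x y, sectionSupport (D.h r x y).1 ⊆ sectionSupport x.1 ∩ sectionSupport y.1
    | .differential => ∀ r, ∃ k, IsSesquiDiff (smoothFunctions d M) k fun x y => D.h r x y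
    | .vey => ∀ r, IsSesquiDiff (smoothFunctions d M) r fun x y => D.h r x y

end Types

end

/-! The theorem is deformation theory of projections. Relative to a Hermitian metric `h₀`, the
sections of `E` have a finite Parseval frame `e k`, with `x = ∑ h₀(e k, x) e k`. So they form the
image of the Hermitian idempotent matrix with entries `h₀(e i, e j)` on a free module.
`IsCompleteRingFiltration.exists_idempotent_lift` deforms this matrix to an idempotent `P` over the
deformed algebra. `P` is again Hermitian if `⋆` is.

Existence: `x ↦ P (h₀(e k, x))ₖ` identifies `E[[λ]]` with the image of `P`, from which right
multiplication and the standard inner product are transported. The inner product is positive as a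
sum of squares, and definite because its lowest order is.

Uniqueness: for any deformation `•`, the map `x ↦ ∑ e k • (embed x) k` is linear over the deformed
algebra and is the identity modulo `λ`, hence an equivalence with the constructed deformation. In
the Hermitian case it pulls the other inner product back to one given by a matrix close to `P` on
the image of `P`, and the square root of that matrix corrects the map to an isometry
(`ProjectiveLift.exists_isIsometry`).

Types: the coefficients of the embedded structures are composed of coefficients of `⋆` and
undeformed module maps. The embedding is inverted one order at a time, so a class of operators
closed under these compositions contains the result (`OperatorClass.AdmE.of_embed`).

Geometry: `M` need not be compact, so a finite frame takes work. `exists_finite_spansFibers`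
compresses a locally finite sequence of sections to finitely many by a dimension count,
`HermitianMetric.exists_dual` supplies dual sections by Cramer's rule, and a smooth Cholesky
decomposition makes the frame Parseval. -/

noncomputable section

/-! ### Formal operators -/

/-- Multiplication of a formal power series by `λ`. -/
def formalShift {X : Type*} [Zero X] (x : ℕ → X) : ℕ → X
  | 0 => 0
  | n + 1 => x n

section Shift

variable {X Y : Type*}

@[simp] theorem formalShift_apply_zero [Zero X] (x : ℕ → X) : formalShift x 0 = 0 := rfl

@[simp] theorem formalShift_apply_succ [Zero X] (x : ℕ → X) (n : ℕ) :
    formalShift x (n + 1) = x n := rfl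

@[simp] theorem formalConst_apply_zero [Zero X] (a : X) : formalConst a 0 = a := by
  simp [formalConst]

@[simp] theorem formalConst_apply_succ [Zero X] (a : X) (n : ℕ) : formalConst a (n + 1) = 0 := by
  simp [formalConst]

theorem formalConst_add [AddZeroClass X] (a b : X) :
    formalConst (a + b) = formalConst a + formalConst b := by
  ext n; cases n <;> simp

theorem formalConst_smul {k : Type*} [Zero X] [SMulZeroClass k X] (c : k) (a : X) :
    formalConst (c • a) = c • formalConst a := by
  ext n; cases n <;> simp

theorem formalConst_add_shift [AddZeroClass X] (x : ℕ → X) :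
    formalConst (x 0) + formalShift (fun n => x (n + 1)) = x := by
  ext n; cases n <;> simp

theorem formalShift_iterate_apply_add [Zero X] (x : ℕ → X) (n i : ℕ) :
    formalShift^[n] x (n + i) = x i := by
  induction n generalizing i with
  | zero => simp
  | succ n ih =>
    rw [Function.iterate_succ_apply', show n + 1 + i = n + i + 1 by omega,
      formalShift_apply_succ, ih]

theorem formalShift_iterate_apply_of_lt [Zero X] (x : ℕ → X) {n i : ℕ} (h : i < n) :
    formalShift^[n] x i = 0 := by
  induction n generalizing i with
  | zero => omega
  | succ n ih =>
    rw [Function.iterate_succ_apply']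
    cases i with
    | zero => rfl
    | succ i => exact ih (by omega)

theorem exists_formalShift_iterate_eq [Zero X] {x : ℕ → X} {n : ℕ} (h : ∀ i < n, x i = 0) :
    formalShift^[n] (fun i => x (n + i)) = x := by
  ext i
  by_cases hi : i < n
  · rw [formalShift_iterate_apply_of_lt _ hi, h i hi]
  · obtain ⟨j, rfl⟩ := Nat.exists_eq_add_of_le (not_lt.1 hi)
    rw [formalShift_iterate_apply_add]

end Shift

/-- An additive operator on formal power series that is semilinear for the scalars and for
`λ`. -/
structure IsFormal {k X Y : Type*} [Semiring k] [AddCommGroup X] [AddCommGroup Y] [Module k X]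
    [Module k Y] (σ : k →+* k) (T : (ℕ → X) → (ℕ → Y)) : Prop where
  map_add : ∀ x y, T (x + y) = T x + T y
  map_smul : ∀ (c : k) x, T (c • x) = σ c • T x
  map_shift : ∀ x, T (formalShift x) = formalShift (T x)

section Formal

variable {k X Y Z : Type*} [CommRing k] [AddCommGroup X] [AddCommGroup Y] [AddCommGroup Z]
  [Module k X] [Module k Y] [Module k Z] {σ : k →+* k}

theorem formalShift_add (x y : ℕ → X) : formalShift (x + y) = formalShift x + formalShift y := by
  ext n; cases n <;> simp

namespace IsFormal

variable {T U : (ℕ → X) → (ℕ → Y)}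

theorem map_zero (hT : IsFormal σ T) : T 0 = 0 := by
  simpa using hT.map_smul 0 0

theorem map_neg (hT : IsFormal σ T) (x : ℕ → X) : T (-x) = -T x := by
  simpa using hT.map_smul (-1) x

theorem map_sub (hT : IsFormal σ T) (x y : ℕ → X) : T (x - y) = T x - T y := by
  rw [sub_eq_add_neg, hT.map_add, hT.map_neg, ← sub_eq_add_neg]

theorem map_sum (hT : IsFormal σ T) {ι : Type*} (s : Finset ι) (x : ι → ℕ → X) :
    T (∑ i ∈ s, x i) = ∑ i ∈ s, T (x i) :=
  _root_.map_sum (AddMonoidHom.mk' T hT.map_add) x s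

theorem map_shift_iterate (hT : IsFormal σ T) (n : ℕ) (x : ℕ → X) :
    T (formalShift^[n] x) = formalShift^[n] (T x) := by
  induction n with
  | zero => rfl
  | succ n ih => rw [Function.iterate_succ_apply', Function.iterate_succ_apply', hT.map_shift, ih]

theorem apply_eq_zero (hT : IsFormal σ T) {n : ℕ} {x : ℕ → X} (h : ∀ i < n, x i = 0) :
    ∀ i < n, T x i = 0 := by
  intro i hi
  rw [← exists_formalShift_iterate_eq h, hT.map_shift_iterate, formalShift_iterate_apply_of_lt _ hi]

theorem apply_zero (hT : IsFormal σ T) (x : ℕ → X) : T x 0 = T (formalConst (x 0)) 0 := by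
  conv_lhs => rw [← formalConst_add_shift x, hT.map_add, hT.map_shift]
  simp

/-- After division by `λⁿ` only the constant term can contribute to order zero. This and its
bilinear analogue drive the order-by-order arguments below. -/
theorem apply_leading (hT : IsFormal σ T) {n : ℕ} {x : ℕ → X} (h : ∀ i < n, x i = 0) :
    T x n = T (formalConst (x n)) 0 := by
  have := formalShift_iterate_apply_add (T fun i => x (n + i)) n 0
  rwa [← hT.map_shift_iterate, exists_formalShift_iterate_eq h, add_zero, hT.apply_zero,
    add_zero] at this

/-- A formal operator is determined by its values on constants. -/
theorem ext (hT : IsFormal σ T) (hU : IsFormal σ U)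
    (h : ∀ x, T (formalConst x) = U (formalConst x)) : T = U := by
  ext x n
  induction n generalizing x with
  | zero => rw [hT.apply_zero, hU.apply_zero, h]
  | succ n ih =>
    -- Beyond its constant term `x` is `λ` times a series, so its contribution is controlled one
    -- order lower.
    rw [← formalConst_add_shift x, hT.map_add, hU.map_add, hT.map_shift, hU.map_shift, h]
    simp [ih]

theorem congr (hT : IsFormal σ T) (h : ∀ x, U x = T x) : IsFormal σ U := by
  rwa [funext h]

theorem id : IsFormal (RingHom.id k) (fun x : ℕ → X => x) :=
  ⟨fun _ _ => rfl, fun _ _ => rfl, fun _ => rfl⟩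

theorem comp {τ ρ : k →+* k} {V : (ℕ → Y) → (ℕ → Z)} (hV : IsFormal τ V) (hT : IsFormal σ T)
    (h : ∀ c, ρ c = τ (σ c) := by intro; rfl) : IsFormal ρ (fun x => V (T x)) :=
  ⟨fun x y => by rw [hT.map_add, hV.map_add], fun c x => by rw [hT.map_smul, hV.map_smul, h],
    fun x => by rw [hT.map_shift, hV.map_shift]⟩

theorem add (hT : IsFormal σ T) (hU : IsFormal σ U) : IsFormal σ (fun x => T x + U x) :=
  ⟨fun x y => by rw [hT.map_add, hU.map_add]; abel,
    fun c x => by rw [hT.map_smul, hU.map_smul, smul_add],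
    fun x => by rw [hT.map_shift, hU.map_shift, formalShift_add]⟩

theorem zero : IsFormal σ (fun _ : ℕ → X => (0 : ℕ → Y)) :=
  ⟨fun _ _ => (add_zero _).symm, fun _ _ => (smul_zero _).symm,
    fun _ => by ext n; cases n <;> rfl⟩

theorem sum {ι : Type*} (s : Finset ι) {V : ι → (ℕ → X) → (ℕ → Y)}
    (hV : ∀ i, IsFormal σ (V i)) : IsFormal σ (fun x => ∑ i ∈ s, V i x) := by
  classical
  induction s using Finset.induction_on with
  | empty => simpa using zero
  | insert i s hi ih => simpa [Finset.sum_insert hi] using (hV i).add ih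

theorem map_apply (f : X →ₛₗ[σ] Y) : IsFormal σ (fun (x : ℕ → X) n => f (x n)) :=
  ⟨fun _ _ => by ext; simp, fun _ _ => by ext; simp, fun _ => by ext n; cases n <;> simp⟩

/-- The coefficients of a formal operator. -/
def coeff (hT : IsFormal σ T) (r : ℕ) : X →ₛₗ[σ] Y where
  toFun x := T (formalConst x) r
  map_add' x y := by rw [formalConst_add, hT.map_add]; rfl
  map_smul' c x := by rw [formalConst_smul, hT.map_smul]; rfl

end IsFormal

theorem formalLin_formalConst (T : ℕ → X →ₛₗ[σ] Y) (x : X) :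
    formalLin (fun r x => T r x) (formalConst x) = fun r => T r x := by
  ext n
  rw [formalLin, Finset.sum_eq_single (n, 0)]
  · simp
  · rintro ⟨i, j⟩ h hne
    cases j with
    | zero => simp at h; simp [h] at hne
    | succ j => simp
  · simp

theorem isFormal_formalLin (T : ℕ → X →ₛₗ[σ] Y) : IsFormal σ (formalLin (fun r x => T r x)) where
  map_add x y := by
    ext n; simp [formalLin, Finset.sum_add_distrib]
  map_smul c x := by
    ext n; simp [formalLin, Finset.smul_sum]
  map_shift x := by
    ext n
    cases n with
    | zero => simp [formalLin]
    | succ n => simp [formalLin, Finset.Nat.sum_antidiagonal_succ']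

theorem IsFormal.formalLin_coeff {T : (ℕ → X) → (ℕ → Y)} (hT : IsFormal σ T) :
    formalLin (fun r x => hT.coeff r x) = T :=
  (isFormal_formalLin _).ext hT fun x => by rw [formalLin_formalConst]; rfl

/-- An operator of two variables that is formal in each variable. -/
structure IsFormal₂ (σ : k →+* k) (B : (ℕ → X) → (ℕ → Y) → (ℕ → Z)) : Prop where
  left : ∀ y, IsFormal σ (fun x => B x y)
  right : ∀ x, IsFormal (RingHom.id k) (fun y => B x y)

namespace IsFormal₂

variable {B B' : (ℕ → X) → (ℕ → Y) → (ℕ → Z)}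

theorem ext (hB : IsFormal₂ σ B) (hB' : IsFormal₂ σ B')
    (h : ∀ x y, B (formalConst x) (formalConst y) = B' (formalConst x) (formalConst y)) :
    B = B' := by
  have h₁ : ∀ x y, B x (formalConst y) = B' x (formalConst y) := fun x y =>
    congrFun ((hB.left _).ext (hB'.left _) fun x => h x y) x
  ext1 x
  exact (hB.right x).ext (hB'.right x) fun y => h₁ x y

theorem apply_zero (hB : IsFormal₂ σ B) (x : ℕ → X) (y : ℕ → Y) :
    B x y 0 = B (formalConst (x 0)) (formalConst (y 0)) 0 := by
  rw [(hB.left y).apply_zero, (hB.right _).apply_zero]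

theorem map_shift_iterate (hB : IsFormal₂ σ B) (m n : ℕ) (x : ℕ → X) (y : ℕ → Y) :
    B (formalShift^[m] x) (formalShift^[n] y) = formalShift^[m + n] (B x y) := by
  rw [(hB.left _).map_shift_iterate, (hB.right _).map_shift_iterate, Function.iterate_add_apply]

theorem apply_eq_zero (hB : IsFormal₂ σ B) {m n : ℕ} {x : ℕ → X} {y : ℕ → Y}
    (hx : ∀ i < m, x i = 0) (hy : ∀ i < n, y i = 0) : ∀ i < m + n, B x y i = 0 := by
  intro i hi
  rw [← exists_formalShift_iterate_eq hx, ← exists_formalShift_iterate_eq hy,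
    hB.map_shift_iterate, formalShift_iterate_apply_of_lt _ hi]

theorem apply_leading (hB : IsFormal₂ σ B) {m n : ℕ} {x : ℕ → X} {y : ℕ → Y}
    (hx : ∀ i < m, x i = 0) (hy : ∀ i < n, y i = 0) :
    B x y (m + n) = B (formalConst (x m)) (formalConst (y n)) 0 := by
  conv_lhs => rw [← exists_formalShift_iterate_eq hx, ← exists_formalShift_iterate_eq hy,
    hB.map_shift_iterate]
  have := formalShift_iterate_apply_add (B (fun i => x (m + i)) (fun i => y (n + i))) (m + n) 0
  rwa [add_zero, hB.apply_zero, add_zero, add_zero] at this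

/-- The coefficients of a formal operator of two variables. -/
def coeff (hB : IsFormal₂ σ B) (r : ℕ) : X →ₛₗ[σ] Y →ₗ[k] Z :=
  LinearMap.mk₂'ₛₗ σ (RingHom.id k) (fun x y => B (formalConst x) (formalConst y) r)
    (fun x x' y => by rw [formalConst_add, (hB.left _).map_add]; rfl)
    (fun c x y => by rw [formalConst_smul, (hB.left _).map_smul]; rfl)
    (fun x y y' => by rw [formalConst_add, (hB.right _).map_add]; rfl)
    (fun c x y => by rw [formalConst_smul, (hB.right _).map_smul]; rfl)

end IsFormal₂

theorem formalBilin_formalConst (B : ℕ → X →ₛₗ[σ] Y →ₗ[k] Z) (x : X) (y : Y) :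
    formalBilin (fun r x y => B r x y) (formalConst x) (formalConst y) = fun r => B r x y := by
  ext n
  rw [formalBilin, Finset.sum_eq_single (n, 0)]
  · simp
  · rintro ⟨i, j⟩ h hne
    cases j with
    | zero => simp at h; simp [h] at hne
    | succ j =>
      refine Finset.sum_eq_zero ?_
      rintro ⟨a, b⟩ hab
      cases a with
      | succ a => simp
      | zero =>
        cases b with
        | succ b => simp
        | zero => simp at hab
  · simp

theorem isFormal₂_formalBilin (B : ℕ → X →ₛₗ[σ] Y →ₗ[k] Z) :
    IsFormal₂ σ (formalBilin (fun r x y => B r x y)) where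
  left y :=
    { map_add := fun x x' => by ext n; simp [formalBilin, Finset.sum_add_distrib]
      map_smul := fun c x => by ext n; simp [formalBilin, Finset.smul_sum]
      map_shift := fun x => by
        ext n
        cases n with
        | zero => simp [formalBilin]
        | succ n =>
          rw [formalBilin, Finset.Nat.sum_antidiagonal_succ']
          simp only [Finset.Nat.sum_antidiagonal_succ, formalShift_apply_succ]
          simp [formalBilin] }
  right x :=
    { map_add := fun x x' => by ext n; simp [formalBilin, Finset.sum_add_distrib]
      map_smul := fun c x => by ext n; simp [formalBilin, Finset.smul_sum]
      map_shift := fun x => by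
        ext n
        cases n with
        | zero => simp [formalBilin]
        | succ n =>
          simp only [formalBilin, Finset.Nat.sum_antidiagonal_succ', formalShift_apply_succ]
          simp }

theorem IsFormal₂.formalBilin_coeff {B : (ℕ → X) → (ℕ → Y) → (ℕ → Z)} (hB : IsFormal₂ σ B) :
    formalBilin (fun r x y => hB.coeff r x y) = B :=
  (isFormal₂_formalBilin _).ext hB fun x y => by rw [formalBilin_formalConst]; rfl

/-! ### Complete filtrations -/

/-- A separated and complete decreasing filtration of an additive group. -/
structure IsCompleteFiltration {G : Type*} [AddCommGroup G] (v : ℕ → AddSubgroup G) : Prop where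
  zero_eq : v 0 = ⊤
  anti : ∀ n, v (n + 1) ≤ v n
  separated : ∀ x, (∀ n, x ∈ v n) → x = 0
  complete : ∀ z : ℕ → G, (∀ n, z (n + 1) - z n ∈ v n) → ∃ w, ∀ n, w - z n ∈ v n

/-- A contraction for a complete filtration has a fixed point. -/
theorem IsCompleteFiltration.exists_fixedPoint {G : Type*} [AddCommGroup G]
    {v : ℕ → AddSubgroup G} (hv : IsCompleteFiltration v) (Φ : G → G) (p : G → Prop)
    (hp : ∀ w, (∀ n, ∃ z, p z ∧ w - z ∈ v n) → p w) {z₀ : G} (h₀ : p z₀)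
    (hΦ : ∀ z, p z → p (Φ z))
    (hc : ∀ n z w, p z → p w → z - w ∈ v n → Φ z - Φ w ∈ v (n + 1)) : ∃ w, p w ∧ Φ w = w := by
  have hz : ∀ n, p (Φ^[n] z₀) := fun n => by
    induction n with
    | zero => exact h₀
    | succ n ih => rw [Function.iterate_succ_apply']; exact hΦ _ ih
  have hd : ∀ n, Φ^[n + 1] z₀ - Φ^[n] z₀ ∈ v n := fun n => by
    induction n with
    | zero => rw [hv.zero_eq]; trivial
    | succ n ih =>
      rw [Function.iterate_succ_apply' Φ (n + 1), Function.iterate_succ_apply' Φ n]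
      exact hc n _ _ (by simpa only [Function.iterate_succ_apply'] using hz (n + 1)) (hz n) (by
        simpa only [Function.iterate_succ_apply'] using ih)
  obtain ⟨w, hw⟩ := hv.complete (fun n => Φ^[n] z₀) hd
  have hpw : p w := hp w fun n => ⟨_, hz n, hw n⟩
  refine ⟨w, hpw, sub_eq_zero.1 (hv.separated _ fun n => hv.anti n ?_)⟩
  have h₁ := hc n _ _ hpw (hz n) (hw n)
  have h₂ := hw (n + 1)
  rw [Function.iterate_succ_apply'] at h₂
  simpa using sub_mem h₁ h₂

/-- The `λ`-adic filtration. -/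
def formalFiltration (X : Type*) [AddCommGroup X] (n : ℕ) : AddSubgroup (ℕ → X) where
  carrier := {x | ∀ i < n, x i = 0}
  add_mem' hx hy i hi := by simp [hx i hi, hy i hi]
  zero_mem' _ _ := rfl
  neg_mem' hx i hi := by simp [hx i hi]

theorem mem_formalFiltration {n : ℕ} {x : ℕ → X} :
    x ∈ formalFiltration X n ↔ ∀ i < n, x i = 0 := Iff.rfl

theorem isCompleteFiltration_formalFiltration : IsCompleteFiltration (formalFiltration X) where
  zero_eq := by ext x; simp [mem_formalFiltration]
  anti n _ hx i hi := hx i (by omega)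
  separated _ hx := funext fun n => hx (n + 1) n (by omega)
  complete z hz := by
    -- The `i`-th coefficient no longer changes from `z (i + 1)` on.
    refine ⟨fun i => z (i + 1) i, fun n i hi => ?_⟩
    obtain ⟨m, rfl⟩ := Nat.exists_eq_add_of_lt hi
    simp only [Pi.sub_apply]
    induction m with
    | zero => simp
    | succ m ih =>
      have h₁ := hz (i + m + 1) i (by omega)
      have h₂ := ih (by omega)
      simp only [Pi.sub_apply] at h₁
      rw [sub_eq_zero] at h₁ h₂ ⊢
      rw [h₂, ← h₁]; rfl

/-! ### Formal operators with identity as lowest order -/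

namespace IsFormal

variable {T : (ℕ → X) → (ℕ → X)}

theorem sub_mem_of_apply_zero (hT : IsFormal (RingHom.id k) T)
    (h : ∀ x, T (formalConst x) 0 = x) {n : ℕ} {x : ℕ → X} (hx : x ∈ formalFiltration X n) :
    T x - x ∈ formalFiltration X (n + 1) := by
  intro i hi
  rcases Nat.lt_succ_iff_lt_or_eq.1 hi with hi | rfl
  · simp [hT.apply_eq_zero hx i hi, hx i hi]
  · simp [hT.apply_leading hx, h]

/-- `T - id` raises the `λ`-adic order. Hence elements with equal images agree to every order, and
`T x = y` is solved by the fixed point of the contraction `x ↦ y - (T x - x)`. -/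
theorem bijective_of_apply_zero (hT : IsFormal (RingHom.id k) T)
    (h : ∀ x, T (formalConst x) 0 = x) : Function.Bijective T := by
  constructor
  · intro x y hxy
    refine sub_eq_zero.1 (isCompleteFiltration_formalFiltration.separated _ fun n => ?_)
    induction n with
    | zero => intro i hi; omega
    | succ n ih =>
      have := hT.sub_mem_of_apply_zero h ih
      rw [hT.map_sub, hxy, sub_self, zero_sub] at this
      simpa using neg_mem this
  · intro y
    obtain ⟨x, -, hx⟩ := isCompleteFiltration_formalFiltration.exists_fixedPoint
      (fun x => y - (T x - x)) (fun _ => True) (fun _ _ => trivial) (z₀ := 0) trivial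
      (fun _ _ => trivial) (fun n z w _ _ hzw => by
        have := neg_mem (hT.sub_mem_of_apply_zero h hzw)
        rw [hT.map_sub] at this
        convert this using 1
        abel)
    refine ⟨x, ?_⟩
    have : y - T x = 0 := by
      calc y - T x = y - (T x - x) - x := by abel
        _ = 0 := by rw [hx, sub_self]
    exact (sub_eq_zero.1 this).symm

theorem of_rightInverse {Y : Type*} [AddCommGroup Y] [Module k Y] {T : (ℕ → X) → (ℕ → Y)}
    (hT : IsFormal (RingHom.id k) T)
    (hinj : Function.Injective T) {S : (ℕ → Y) → (ℕ → X)} (hS : ∀ y, T (S y) = y) :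
    IsFormal (RingHom.id k) S where
  map_add x y := hinj (by rw [hS, hT.map_add, hS, hS])
  map_smul c x := hinj (by rw [hS, hT.map_smul, hS]; rfl)
  map_shift x := hinj (by rw [hS, hT.map_shift, hS])

end IsFormal

end Formal

end

noncomputable section

/-! ### Inverse square roots and idempotents in complete filtered rings -/

section FilteredRing

variable {R : Type*} [Ring R] [Algebra ℂ R]

/-- A complete filtration of an algebra by two-sided ideals, compatible with products. -/
structure IsCompleteRingFiltration (v : ℕ → AddSubgroup R) : Prop
    extends IsCompleteFiltration v where
  mul_mem : ∀ m n x y, x ∈ v m → y ∈ v n → x * y ∈ v (m + n)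
  smul_mem : ∀ n (c : ℂ) x, x ∈ v n → c • x ∈ v n

/-- A filtered additive antihomomorphism. -/
structure IsFilteredAntihom (v : ℕ → AddSubgroup R) (σ : R →+ R) : Prop where
  map_mul : ∀ x y, σ (x * y) = σ y * σ x
  map_one : σ 1 = 1
  map_mem : ∀ n x, x ∈ v n → σ x ∈ v n

variable {v : ℕ → AddSubgroup R}

theorem IsCompleteRingFiltration.mul_mem_left (hv : IsCompleteRingFiltration v) {n : ℕ} (x : R)
    {y : R} (hy : y ∈ v n) : x * y ∈ v n := by
  have := hv.mul_mem 0 n x y (by rw [hv.zero_eq]; trivial) hy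
  rwa [zero_add] at this

theorem IsCompleteRingFiltration.mul_mem_right (hv : IsCompleteRingFiltration v) {n : ℕ} {x : R}
    (hx : x ∈ v n) (y : R) : x * y ∈ v n :=
  hv.mul_mem n 0 x y hx (by rw [hv.zero_eq]; trivial)

/-- Halving inverts doubling, which every additive map respects. Additivity is all that is
available, since conjugate transposition is not complex linear. -/
theorem map_half_smul (σ : R →+ R) (x : R) : σ ((1 / 2 : ℂ) • x) = (1 / 2 : ℂ) • σ x := by
  have h : ∀ y : R, (1 / 2 : ℂ) • y + (1 / 2 : ℂ) • y = y := fun y => by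
    rw [← add_smul]; norm_num
  have h' : (2 : ℂ) • σ ((1 / 2 : ℂ) • x) = σ x := by
    rw [two_smul, ← map_add, h]
  rw [← h', smul_smul]; norm_num

/-- In a complete filtered ring every element close to `1` has an inverse square root in its
double commutant. -/
theorem IsCompleteRingFiltration.exists_invSqrt (hv : IsCompleteRingFiltration v) {X : R}
    (hX : X - 1 ∈ v 1) :
    ∃ W : R, W - 1 ∈ v 1 ∧ W * W * X = 1 ∧ (∀ C, Commute C X → Commute C W) ∧
      ∀ σ : R →+ R, IsFilteredAntihom v σ → σ X = X → σ W = W := by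
  obtain ⟨K, rfl⟩ : ∃ K, X = 1 + K := ⟨X - 1, by abel⟩
  rw [add_sub_cancel_left] at hX
  -- Kernels of filtered additive maps are closed, so commutation and invariance conditions pass to
  -- the limit of the iteration.
  have hclosed : ∀ f : R →+ R, (∀ n x, x ∈ v n → f x ∈ v n) → ∀ w,
      (∀ n, ∃ z, f z = 0 ∧ w - z ∈ v n) → f w = 0 := fun f hf w hw =>
    hv.separated _ fun n => by
      obtain ⟨z, hz, hwz⟩ := hw n
      have := hf n _ hwz
      rwa [map_sub, hz, sub_zero] at this
  -- With `W = 1 + Z` and `X = 1 + K`, where `Z` and `K` commute, `W² X = 1` reads `2Z = -(Z² + K +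
  -- 2ZK + Z²K)`. The right side is a contraction on `v 1` because each factor `Z` or `K` raises the
  -- filtration degree.
  obtain ⟨Z, ⟨hZ₁, hZ₂, hZ₃⟩, hZ⟩ := hv.exists_fixedPoint
    (fun Z => (1 / 2 : ℂ) • (-(Z * Z + K + Z * K + Z * K + Z * Z * K)))
    (fun Z => Z ∈ v 1 ∧ (∀ C, Commute C (1 + K) → Commute C Z) ∧
      ∀ σ : R →+ R, IsFilteredAntihom v σ → σ (1 + K) = 1 + K → σ Z = Z)
    (by
      intro w hw
      refine ⟨?_, fun C hC => ?_, fun σ hσ hσX => ?_⟩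
      · obtain ⟨z, hz, hwz⟩ := hw 1
        simpa using add_mem hwz hz.1
      · refine sub_eq_zero.1 (hclosed (AddMonoidHom.mulLeft C - AddMonoidHom.mulRight C)
          (fun n x hx => sub_mem (hv.mul_mem_left C hx) (hv.mul_mem_right hx C)) w fun n => ?_)
        obtain ⟨z, hz, hwz⟩ := hw n
        exact ⟨z, sub_eq_zero.2 (hz.2.1 C hC), hwz⟩
      · refine sub_eq_zero.1 (hclosed (σ - AddMonoidHom.id R)
          (fun n x hx => sub_mem (hσ.map_mem n x hx) hx) w fun n => ?_)
        obtain ⟨z, hz, hwz⟩ := hw n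
        exact ⟨z, sub_eq_zero.2 (hz.2.2 σ hσ hσX), hwz⟩)
    (z₀ := 0) ⟨zero_mem _, fun C _ => Commute.zero_right C, fun σ _ _ => map_zero σ⟩
    (by
      rintro Z ⟨h₁, h₂, h₃⟩
      refine ⟨hv.smul_mem _ _ _ (neg_mem ?_), fun C hC => ?_, fun σ hσ hσX => ?_⟩
      · exact add_mem (add_mem (add_mem (add_mem (hv.mul_mem_left _ h₁) hX)
          (hv.mul_mem_left _ hX)) (hv.mul_mem_left _ hX)) (hv.mul_mem_left _ hX)
      · have hCK : Commute C K := by simpa using hC.sub_right (Commute.one_right C)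
        have hCZ := h₂ C hC
        exact (((((hCZ.mul_right hCZ).add_right hCK).add_right (hCZ.mul_right hCK)).add_right
          (hCZ.mul_right hCK)).add_right ((hCZ.mul_right hCZ).mul_right hCK)).neg_right.smul_right _
      · have hK : σ K = K := by rw [map_add, hσ.map_one] at hσX; exact add_left_cancel hσX
        -- `σ` reverses products; the terms `Z K` are restored because `K` itself lies in the
        -- commutant of `X`.
        have hKZ : K * Z = Z * K :=
          h₂ K ((Commute.one_right K).add_right (Commute.refl K))
        rw [map_half_smul]
        simp only [map_neg, map_add, hσ.map_mul, h₃ σ hσ hσX, hK, hKZ, ← mul_assoc]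
        rw [mul_assoc Z K Z, hKZ, ← mul_assoc])
    (by
      rintro n Z W ⟨h₁, -, -⟩ ⟨h₂, -, -⟩ h
      rw [← smul_sub]
      refine hv.smul_mem _ _ _ ?_
      have e : -(Z * Z + K + Z * K + Z * K + Z * Z * K) - -(W * W + K + W * K + W * K + W * W * K) =
          -((Z * (Z - W) + (Z - W) * W) + (Z - W) * K + (Z - W) * K +
            (Z * (Z - W) + (Z - W) * W) * K) := by noncomm_ring
      rw [e]
      have a₁ : Z * (Z - W) ∈ v (n + 1) := by
        have := hv.mul_mem _ _ _ _ h₁ h; rwa [add_comm] at this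
      have a₂ : (Z - W) * W ∈ v (n + 1) := hv.mul_mem _ _ _ _ h h₂
      have a₃ : (Z - W) * K ∈ v (n + 1) := hv.mul_mem _ _ _ _ h hX
      exact neg_mem (add_mem (add_mem (add_mem (add_mem a₁ a₂) a₃) a₃)
        (hv.mul_mem_right (add_mem a₁ a₂) K)))
  refine ⟨1 + Z, by simpa using hZ₁, ?_, fun C hC => (Commute.one_right C).add_right (hZ₂ C hC),
    fun σ hσ hσX => by rw [map_add, hσ.map_one, hZ₃ σ hσ hσX]⟩
  have h2 : Z + Z = -(Z * Z + K + Z * K + Z * K + Z * Z * K) := by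
    conv_lhs => rw [← hZ]
    rw [← add_smul]; norm_num
  have e : (1 + Z) * (1 + Z) * (1 + K) =
      1 + ((Z + Z) + (Z * Z + K + Z * K + Z * K + Z * Z * K)) := by noncomm_ring
  rw [e, h2, neg_add_cancel, add_zero]

/-- Idempotents lift through complete filtrations, compatibly with antihomomorphisms. -/
theorem IsCompleteRingFiltration.exists_idempotent_lift (hv : IsCompleteRingFiltration v) {N : R}
    (hN : N * N - N ∈ v 1) :
    ∃ P : R, P - N ∈ v 1 ∧ P * P = P ∧
      ∀ σ : R →+ R, IsFilteredAntihom v σ → σ N = N → σ P = P := by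
  -- Idempotents `P` correspond to involutions `2P - 1`. Here `Y² - 1 = 4(N² - N)` is small, and
  -- multiplying `Y` by an inverse square root `W` of `Y²` makes it an exact involution. `W`
  -- commutes with `Y` because it lies in the double commutant of `Y²`.
  set Y : R := N + N - 1 with hY
  have hX : Y * Y - 1 ∈ v 1 := by
    have : Y * Y - 1 = (N * N - N) + (N * N - N) + ((N * N - N) + (N * N - N)) := by
      rw [hY]; noncomm_ring
    rw [this]
    exact add_mem (add_mem hN hN) (add_mem hN hN)
  obtain ⟨W, hW₁, hW, hWc, hWσ⟩ := hv.exists_invSqrt hX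
  have hYW : Y * W = W * Y := hWc Y ((Commute.refl Y).mul_right (Commute.refl Y))
  have hsq : Y * W * (Y * W) = 1 := by
    have hc : Commute (Y * Y) W := hWc _ (Commute.refl _)
    calc Y * W * (Y * W) = Y * (W * Y) * W := by noncomm_ring
      _ = (Y * Y) * W * W := by rw [← hYW]; noncomm_ring
      _ = W * W * (Y * Y) := by rw [hc.eq, mul_assoc, hc.eq, ← mul_assoc]
      _ = 1 := hW
  have half : ∀ y : R, (1 / 2 : ℂ) • (y + y) = y := fun y => by
    rw [← two_smul ℂ, smul_smul]; norm_num
  refine ⟨(1 / 2 : ℂ) • (1 + Y * W), ?_, ?_, fun σ hσ hσN => ?_⟩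
  · have : (1 / 2 : ℂ) • (1 + Y * W) - N = (1 / 2 : ℂ) • (Y * (W - 1)) := by
      conv_lhs => rw [← half N, ← smul_sub]
      rw [hY]; congr 1; noncomm_ring
    rw [this]
    exact hv.smul_mem _ _ _ (hv.mul_mem_left _ hW₁)
  · rw [smul_mul_smul_comm]
    have : (1 + Y * W) * (1 + Y * W) = (1 + Y * W) + (1 + Y * W) := by
      rw [mul_add, add_mul, add_mul, hsq, one_mul, mul_one, one_mul]; abel
    rw [this, mul_smul, half]
  · have hσY : σ Y = Y := by rw [hY, map_sub, map_add, hσN, hσ.map_one]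
    have hσX : σ (Y * Y) = Y * Y := by rw [hσ.map_mul, hσY]
    rw [map_half_smul, map_add, hσ.map_one, hσ.map_mul, hσY, hWσ σ hσ hσX, hYW]

end FilteredRing

/-! ### The deformed algebra -/

namespace FormalDeformation

section Alg

variable {k A : Type*} [CommRing k] [CommRing A] [Algebra k A]

/-- The deformed algebra `(A[[λ]], ⋆)`. -/
@[nolint unusedArguments]
def Alg (_ : FormalDeformation k A) : Type _ := ℕ → A

variable (S : FormalDeformation k A)

instance : AddCommGroup S.Alg := inferInstanceAs (AddCommGroup (ℕ → A))

instance : Module k S.Alg := inferInstanceAs (Module k (ℕ → A))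

theorem isFormal₂_mul : IsFormal₂ (RingHom.id k) S.mul := isFormal₂_formalBilin S.C

theorem mul_formalConst (a b : A) : S.mul (formalConst a) (formalConst b) = fun r => S.C r a b :=
  formalBilin_formalConst S.C a b

theorem mul_apply_zero (a b : ℕ → A) : S.mul a b 0 = a 0 * b 0 := by
  rw [S.isFormal₂_mul.apply_zero, mul_formalConst]
  exact S.C_zero _ _

instance : Ring S.Alg :=
  { (inferInstance : AddCommGroup S.Alg) with
    mul := S.mul
    one := formalConst (1 : A)
    mul_assoc := S.assoc
    one_mul := S.one_left
    mul_one := S.one_right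
    left_distrib := fun a => (S.isFormal₂_mul.right a).map_add
    right_distrib := fun a b c => (S.isFormal₂_mul.left c).map_add a b
    zero_mul := fun a => (S.isFormal₂_mul.left a).map_zero
    mul_zero := fun a => (S.isFormal₂_mul.right a).map_zero }

instance : Algebra k S.Alg :=
  Algebra.ofModule (fun c a b => (S.isFormal₂_mul.left b).map_smul c a)
    (fun c a b => (S.isFormal₂_mul.right a).map_smul c b)

end Alg

variable {A : Type*} [CommRing A] [Algebra ℂ A] (S : FormalDeformation ℂ A)

/-- The `λ`-adic filtration of the deformed algebra. -/
def filtration (n : ℕ) : AddSubgroup S.Alg := formalFiltration A n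

/-- The `λ`-adic filtration of matrices over the deformed algebra. -/
def matrixFiltration (ι : Type*) (n : ℕ) : AddSubgroup (Matrix ι ι S.Alg) where
  carrier := {x | ∀ i j, x i j ∈ S.filtration n}
  add_mem' hx hy i j := add_mem (hx i j) (hy i j)
  zero_mem' _ _ := zero_mem _
  neg_mem' hx i j := neg_mem (hx i j)

theorem mem_matrixFiltration {ι : Type*} {n : ℕ} {x : Matrix ι ι S.Alg} :
    x ∈ S.matrixFiltration ι n ↔ ∀ i j, x i j ∈ S.filtration n := Iff.rfl

theorem mem_filtration_one {a : S.Alg} : a ∈ S.filtration 1 ↔ (a : ℕ → A) 0 = 0 :=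
  ⟨fun h => h 0 one_pos, fun h i hi => by obtain rfl : i = 0 := by omega
                                          exact h⟩

theorem isCompleteRingFiltration_matrix (ι : Type*) [Fintype ι] [DecidableEq ι] :
    IsCompleteRingFiltration (S.matrixFiltration ι) where
  zero_eq := by
    ext x
    simp only [mem_matrixFiltration, AddSubgroup.mem_top, iff_true]
    intro i j m hm
    omega
  anti n x hx i j := isCompleteFiltration_formalFiltration.anti n (hx i j)
  separated x hx := by
    ext i j : 2
    exact isCompleteFiltration_formalFiltration.separated _ fun n => hx n i j
  complete z hz := by
    have := fun i j => isCompleteFiltration_formalFiltration.complete (fun n => z n i j)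
      fun n => hz n i j
    choose w hw using this
    exact ⟨w, fun n i j => hw i j n⟩
  mul_mem m n x y hx hy i j := by
    rw [Matrix.mul_apply]
    exact sum_mem fun l _ => S.isFormal₂_mul.apply_eq_zero (hx i l) (hy l j)
  smul_mem n c x hx i j l hl := by
    change c • (x i j : ℕ → A) l = 0
    rw [hx i j l hl, smul_zero]

variable {S} [StarRing A]

instance : StarAddMonoid S.Alg := inferInstanceAs (StarAddMonoid (ℕ → A))

/-- The involution of a Hermitian deformation. -/
@[reducible]
def IsHermitian.starRing (hS : S.IsHermitian) : StarRing S.Alg :=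
  { (inferInstance : StarAddMonoid S.Alg) with
    star_mul := hS }

theorem IsHermitian.isFilteredAntihom (hS : S.IsHermitian) (ι : Type*) [Fintype ι]
    [DecidableEq ι] :
    IsFilteredAntihom (S.matrixFiltration ι)
      (AddMonoidHom.mk' Matrix.conjTranspose Matrix.conjTranspose_add) := by
  let := hS.starRing
  exact
  { map_mul := Matrix.conjTranspose_mul
    map_one := Matrix.conjTranspose_one
    map_mem := fun n x hx i j m hm => by
      have h : (x j i : ℕ → A) m = 0 := hx j i m hm
      change star ((x j i : ℕ → A) m) = 0
      rw [h, star_zero] }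

end FormalDeformation

end

noncomputable section

/-! ### Deformed modules from formal operators -/

section Deformation

variable {A : Type*} [CommRing A] [Algebra ℂ A] {S : FormalDeformation ℂ A}
  {E : Type*} [AddCommGroup E] [Module ℂ E] [Module A E]

theorem FormalDeformation.Alg.sum_apply {ι : Type*} (s : Finset ι) (f : ι → S.Alg) (n : ℕ) :
    (∑ i ∈ s, f i : S.Alg) n = ∑ i ∈ s, f i n :=
  Finset.sum_apply (M := fun _ : ℕ => A) n s f

theorem FormalDeformation.isFormal_mul_left (a : S.Alg) {X : Type*} [AddCommGroup X] [Module ℂ X]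
    {T : (ℕ → X) → S.Alg} (hT : IsFormal (Y := A) (RingHom.id ℂ) T) :
    IsFormal (Y := A) (RingHom.id ℂ) (fun x => a * T x) :=
  (S.isFormal₂_mul.right a).comp hT

theorem FormalDeformation.isFormal_mul_right (a : S.Alg) {X : Type*} [AddCommGroup X] [Module ℂ X]
    {T : (ℕ → X) → S.Alg} (hT : IsFormal (Y := A) (RingHom.id ℂ) T) :
    IsFormal (Y := A) (RingHom.id ℂ) (fun x => T x * a) :=
  (S.isFormal₂_mul.left a).comp hT

namespace ModuleDeformation

theorem isFormal₂_act (D : ModuleDeformation S E) : IsFormal₂ (RingHom.id ℂ) D.act :=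
  isFormal₂_formalBilin D.R

theorem act_formalConst (D : ModuleDeformation S E) (x : E) (a : A) :
    D.act (formalConst x) (formalConst a) = fun r => D.R r x a :=
  formalBilin_formalConst D.R x a

theorem act_formalConst_zero (D : ModuleDeformation S E) (x : E) (a : A) :
    D.act (formalConst x) (formalConst a) 0 = a • x := by
  rw [act_formalConst]; exact D.R_zero x a

theorem act_apply_zero (D : ModuleDeformation S E) (x : ℕ → E) (a : ℕ → A) :
    D.act x a 0 = a 0 • x 0 := by
  rw [D.isFormal₂_act.apply_zero, act_formalConst_zero]

theorem act_act (D : ModuleDeformation S E) (x : ℕ → E) (a b : S.Alg) :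
    D.act (D.act x a) b = D.act x (a * b : S.Alg) :=
  D.act_mul x a b

/-- The deformed module with a given formal action. -/
def ofAct (B : (ℕ → E) → (ℕ → A) → (ℕ → E)) (hB : IsFormal₂ (RingHom.id ℂ) B)
    (h₀ : ∀ x a, B (formalConst x) (formalConst a) 0 = a • x)
    (hmul : ∀ x a b, B (B x a) b = B x (S.mul a b)) (hone : ∀ x, B x (formalConst 1) = x) :
    ModuleDeformation S E where
  R := hB.coeff
  R_zero := h₀
  act_mul x a b := by rw [hB.formalBilin_coeff]; exact hmul x a b
  act_one x := by rw [hB.formalBilin_coeff]; exact hone x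

theorem ofAct_act {B : (ℕ → E) → (ℕ → A) → (ℕ → E)} (hB : IsFormal₂ (RingHom.id ℂ) B)
    (h₀ : ∀ x a, B (formalConst x) (formalConst a) 0 = a • x)
    (hmul : ∀ x a b, B (B x a) b = B x (S.mul a b)) (hone : ∀ x, B x (formalConst 1) = x) :
    (ofAct B hB h₀ hmul hone).act = B :=
  hB.formalBilin_coeff

/-- An equivalence of deformed modules, as an operator on formal power series. -/
structure IsEquivOp (D D' : ModuleDeformation S E) (T : (ℕ → E) → (ℕ → E)) : Prop where
  formal : IsFormal (RingHom.id ℂ) T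
  apply_zero : ∀ x, T (formalConst x) 0 = x
  map_act : ∀ x a, T (D.act x a) = D'.act (T x) a

namespace IsEquivOp

variable {D D' D'' : ModuleDeformation S E} {T U : (ℕ → E) → (ℕ → E)}

theorem isEquivalence (hT : D.IsEquivOp D' T) : D.IsEquivalence D' hT.formal.coeff where
  T_zero := LinearMap.ext hT.apply_zero
  bijective := by
    rw [hT.formal.formalLin_coeff]; exact hT.formal.bijective_of_apply_zero hT.apply_zero
  map_act x a := by rw [hT.formal.formalLin_coeff]; exact hT.map_act x a

theorem comp (hU : D'.IsEquivOp D'' U) (hT : D.IsEquivOp D' T) :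
    D.IsEquivOp D'' (fun x => U (T x)) where
  formal := hU.formal.comp hT.formal
  apply_zero x := by rw [hU.formal.apply_zero, hT.apply_zero, hU.apply_zero]
  map_act x a := by rw [hT.map_act, hU.map_act]

theorem exists_inverse (hT : D.IsEquivOp D' T) : ∃ U, D'.IsEquivOp D U ∧ ∀ x, T (U x) = x := by
  have hb := hT.formal.bijective_of_apply_zero hT.apply_zero
  choose U hU using hb.2
  have hUf := hT.formal.of_rightInverse hb.1 hU
  refine ⟨U, ⟨hUf, fun x => ?_, fun x a => hb.1 ?_⟩, hU⟩
  · have := congrFun (hU (formalConst x)) 0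
    rw [hT.formal.apply_zero, hT.apply_zero, formalConst_apply_zero] at this
    exact this
  · rw [hU, hT.map_act, hU]

end IsEquivOp

end ModuleDeformation

/-! ### Lifts of finitely generated projective modules -/

/-- A presentation of `E` as a direct summand of a finite free module, by generators `e` and
coordinates `a`, together with an idempotent matrix over the deformed algebra that deforms the
corresponding projection. -/
structure ProjectiveLift (S : FormalDeformation ℂ A) (E : Type*) [AddCommGroup E] [Module ℂ E]
    [Module A E] (ι : Type*) [Fintype ι] where
  e : ι → E
  a : ι → E →ₗ[A] A
  sum_smul : ∀ x, ∑ k, a k x • e k = x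
  P : Matrix ι ι S.Alg
  idem : P * P = P
  P_zero : ∀ i j, (P i j : ℕ → A) 0 = a i (e j)

/-- The constant matrix with entries `a i (e j)` is idempotent modulo `λ` by the reconstruction
formula `h`, so it lifts. The lift is fixed by every filtered antihomomorphism that fixes this
matrix, in particular by conjugate transposition in the Hermitian case. -/
theorem exists_projectiveLift {ι : Type*} [Fintype ι] [DecidableEq ι] (S : FormalDeformation ℂ A)
    (e : ι → E) (a : ι → E →ₗ[A] A) (h : ∀ x, ∑ k, a k x • e k = x) :
    ∃ L : ProjectiveLift S E ι, L.e = e ∧ L.a = a ∧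
      ∀ [StarRing A], S.IsHermitian → (∀ i j, star (a i (e j)) = a j (e i)) →
        L.P.conjTranspose = L.P := by
  set N : Matrix ι ι S.Alg := fun i j => (formalConst (a i (e j)) : ℕ → A) with hN
  obtain ⟨P, hP₁, hP, hPσ⟩ := (S.isCompleteRingFiltration_matrix ι).exists_idempotent_lift
    (N := N) (by
      intro i j
      rw [S.mem_filtration_one]
      change ((N * N) i j : ℕ → A) 0 - (formalConst (a i (e j)) : ℕ → A) 0 = 0
      rw [Matrix.mul_apply, FormalDeformation.Alg.sum_apply, sub_eq_zero, formalConst_apply_zero]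
      conv_rhs => rw [← h (e j), map_sum]
      refine Finset.sum_congr rfl fun l _ => ?_
      rw [map_smul, smul_eq_mul, mul_comm]
      refine (S.mul_apply_zero _ _).trans ?_
      exact congrArg₂ _ (formalConst_apply_zero _) (formalConst_apply_zero _))
  refine ⟨⟨e, a, h, P, hP, fun i j => ?_⟩, rfl, rfl, fun hS hh => ?_⟩
  · have : (P i j : ℕ → A) 0 - (formalConst (a i (e j)) : ℕ → A) 0 = 0 :=
      S.mem_filtration_one.1 (hP₁ i j)
    rwa [formalConst_apply_zero, sub_eq_zero] at this
  · refine hPσ _ (hS.isFilteredAntihom ι) ?_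
    ext i j : 2
    change star (formalConst (a j (e i))) = formalConst (a i (e j))
    ext n
    cases n <;> simp [hh]

namespace ProjectiveLift

open Matrix

variable {ι : Type*} [Fintype ι] (L : ProjectiveLift S E ι)

/-- The undeformed coordinates. -/
def coords (x : ℕ → E) : ι → S.Alg := fun k n => L.a k (x n)

/-- The embedding of `E[[λ]]` onto the image of the deformed projection. -/
def embed (x : ℕ → E) : ι → S.Alg := L.P *ᵥ L.coords x

/-- The undeformed evaluation of coordinates. -/
def eval (v : ι → S.Alg) : ℕ → E := fun n => ∑ k, (v k : ℕ → A) n • L.e k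

theorem embed_apply (x : ℕ → E) (k : ι) : L.embed x k = ∑ j, L.P k j * L.coords x j := rfl

theorem embed_apply_zero (x : ℕ → E) (k : ι) : (L.embed x k : ℕ → A) 0 = L.a k (x 0) := by
  rw [embed_apply, FormalDeformation.Alg.sum_apply]
  conv_rhs => rw [← L.sum_smul (x 0), map_sum]
  refine Finset.sum_congr rfl fun j _ => (S.mul_apply_zero _ _).trans ?_
  rw [L.P_zero, map_smul, smul_eq_mul, mul_comm]
  rfl

theorem mulVec_embed (x : ℕ → E) : L.P *ᵥ L.embed x = L.embed x := by
  rw [embed, Matrix.mulVec_mulVec, L.idem]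

theorem eval_sub (v w : ι → S.Alg) : L.eval (v - w) = L.eval v - L.eval w := by
  ext n
  simp only [eval, Pi.sub_apply, ← Finset.sum_sub_distrib]
  exact Finset.sum_congr rfl fun k _ => sub_smul _ _ _

theorem eval_embed_zero (x : ℕ → E) : L.eval (L.embed x) 0 = x 0 := by
  simp only [eval, embed_apply_zero]
  exact L.sum_smul _

/-- The leading coefficient of a fixed vector of `P` is fixed by the undeformed projection. That
projection factors through evaluation, so the coefficient vanishes, and the argument repeats one
order higher. -/
theorem eq_zero_of_eval_eq_zero {v : ι → S.Alg} (hv : L.P *ᵥ v = v) (h : L.eval v = 0) :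
    v = 0 := by
  have key : ∀ n k, ∀ i < n, (v k : ℕ → A) i = 0 := by
    intro n
    induction n with
    | zero => intro k i hi; omega
    | succ n ih =>
      intro k i hi
      rcases Nat.lt_succ_iff_lt_or_eq.1 hi with hi | rfl
      · exact ih k i hi
      · have h₁ : (v k : ℕ → A) i = ∑ j, L.a k (L.e j) * (v j : ℕ → A) i := by
          conv_lhs => rw [← hv]
          change ((∑ j, L.P k j * v j : S.Alg) : ℕ → A) i = _
          rw [FormalDeformation.Alg.sum_apply]
          refine Finset.sum_congr rfl fun j _ => ?_
          refine ((S.isFormal₂_mul.right (L.P k j)).apply_leading (ih j)).trans ?_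
          exact (S.mul_apply_zero _ _).trans (congrArg₂ _ (L.P_zero k j) (formalConst_apply_zero _))
        have h₂ := congrArg (L.a k) (congrFun h i)
        rw [h₁]
        simp only [eval, map_sum, map_smul, Pi.zero_apply, map_zero, smul_eq_mul] at h₂
        rw [← h₂]
        exact Finset.sum_congr rfl fun j _ => mul_comm _ _
  ext k
  funext i
  exact key (i + 1) k i (by omega)

theorem mulVec_mul_right (M : Matrix ι ι S.Alg) (v : ι → S.Alg) (f : S.Alg) :
    (M *ᵥ fun k => v k * f) = fun k => (M *ᵥ v) k * f := by
  ext k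
  simp only [mulVec, dotProduct, Finset.sum_mul, mul_assoc]

/-- The deformed evaluation of coordinates in a deformation of `E`. -/
def evalAct (D : ModuleDeformation S E) (v : ι → S.Alg) : ℕ → E :=
  ∑ k, D.act (formalConst (L.e k)) (v k)

theorem evalAct_mul (D : ModuleDeformation S E) (v : ι → S.Alg) (f : S.Alg) :
    L.evalAct D (fun k => v k * f) = D.act (L.evalAct D v) f := by
  rw [evalAct, evalAct, (D.isFormal₂_act.left f).map_sum]
  exact Finset.sum_congr rfl fun k _ => (D.act_act _ _ _).symm

variable [IsScalarTower ℂ A E]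

theorem isFormal_embed (k : ι) :
    IsFormal (Y := A) (RingHom.id ℂ) (fun x => L.embed x k) :=
  IsFormal.sum (Y := A) (V := fun j x => L.P k j * L.coords x j)
    Finset.univ fun j => S.isFormal_mul_left _ (IsFormal.map_apply ((L.a j).restrictScalars ℂ))

theorem isFormal_eval {X : Type*} [AddCommGroup X] [Module ℂ X] {T : (ℕ → X) → ι → S.Alg}
    (hT : ∀ k, IsFormal (Y := A) (RingHom.id ℂ) (fun x => T x k)) :
    IsFormal (RingHom.id ℂ) (fun x => L.eval (T x)) := by
  have := IsFormal.sum Finset.univ fun k =>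
    (IsFormal.map_apply ((LinearMap.toSpanSingleton A E (L.e k)).restrictScalars ℂ)).comp
      (ρ := RingHom.id ℂ) (hT k)
  refine cast (congrArg _ (funext fun x => funext fun n => ?_)) this
  rw [Finset.sum_apply]
  rfl

theorem embed_injective : Function.Injective L.embed := by
  intro x y h
  exact ((L.isFormal_eval L.isFormal_embed).bijective_of_apply_zero fun x => by
    rw [eval_embed_zero, formalConst_apply_zero]).1 (congrArg L.eval h)

/-- The composite of `embed` and `eval` is the identity modulo `λ`, hence onto. A preimage of `eval
v` embeds to an element of the image of `P` with the same evaluation as `v`, and `eval` is injective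
there. -/
theorem exists_embed_eq {v : ι → S.Alg} (hv : L.P *ᵥ v = v) : ∃ x, L.embed x = v := by
  obtain ⟨x, hx⟩ := ((L.isFormal_eval L.isFormal_embed).bijective_of_apply_zero fun x => by
    rw [eval_embed_zero, formalConst_apply_zero]).2 (L.eval v)
  refine ⟨x, sub_eq_zero.1 (L.eq_zero_of_eval_eq_zero ?_ ?_)⟩
  · rw [Matrix.mulVec_sub, mulVec_embed, hv]
  · rw [eval_sub, sub_eq_zero]; exact hx

theorem exists_act (x : ℕ → E) (f : S.Alg) :
    ∃ y, L.embed y = fun k => L.embed x k * f :=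
  L.exists_embed_eq (by
    rw [mulVec_mul_right, mulVec_embed])

/-- The action of the deformed algebra transported from the image of the deformed projection. -/
def act (x : ℕ → E) (f : S.Alg) : ℕ → E := (L.exists_act x f).choose

theorem embed_act (x : ℕ → E) (f : S.Alg) :
    L.embed (L.act x f) = fun k => L.embed x k * f :=
  (L.exists_act x f).choose_spec

theorem embed_eq_iff {x y : ℕ → E} : x = y ↔ ∀ k, L.embed x k = L.embed y k :=
  ⟨fun h _ => by rw [h], fun h => L.embed_injective (funext h)⟩

/-- The embedding is formal and injective, so it reflects formality. This handles maps such as `act`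
that are given only by a choice of preimages. -/
theorem isFormal_of_embed {X : Type*} [AddCommGroup X] [Module ℂ X] {T : (ℕ → X) → (ℕ → E)}
    (h : ∀ k, IsFormal (Y := A) (RingHom.id ℂ) (fun x => L.embed (T x) k)) :
    IsFormal (RingHom.id ℂ) T where
  map_add x y := L.embed_eq_iff.2 fun k => by
    rw [(L.isFormal_embed k).map_add]; exact (h k).map_add x y
  map_smul c x := L.embed_eq_iff.2 fun k => by
    rw [(L.isFormal_embed k).map_smul]; exact (h k).map_smul c x
  map_shift x := L.embed_eq_iff.2 fun k => by
    rw [(L.isFormal_embed k).map_shift]; exact (h k).map_shift x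

theorem isFormal₂_act : IsFormal₂ (Y := A) (RingHom.id ℂ) L.act where
  left f := L.isFormal_of_embed fun k =>
    (S.isFormal_mul_right f (L.isFormal_embed k)).congr fun x => congrFun (L.embed_act x f) k
  right x := L.isFormal_of_embed fun k =>
    (S.isFormal_mul_left (L.embed x k) (IsFormal.id (X := A))).congr fun f =>
      congrFun (L.embed_act x f) k

theorem act_apply_zero (x : ℕ → E) (f : S.Alg) : L.act x f 0 = (f : ℕ → A) 0 • x 0 := by
  have h : ∀ k, L.a k (L.act x f 0) = L.a k ((f : ℕ → A) 0 • x 0) := fun k => by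
    rw [← embed_apply_zero, embed_act]
    refine (S.mul_apply_zero _ _).trans ?_
    rw [map_smul, smul_eq_mul, mul_comm]
    exact congrArg _ (L.embed_apply_zero x k)
  rw [← L.sum_smul (L.act x f 0), ← L.sum_smul ((f : ℕ → A) 0 • x 0)]
  exact Finset.sum_congr rfl fun k _ => by rw [h]

theorem act_act (x : ℕ → E) (a b : S.Alg) : L.act (L.act x a) b = L.act x (a * b) :=
  L.embed_eq_iff.2 fun k => by simp only [embed_act, mul_assoc]

theorem act_one (x : ℕ → E) : L.act x 1 = x :=
  L.embed_eq_iff.2 fun k => by simp only [embed_act, mul_one]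

/-- The deformation of `E` defined by a deformation of the corresponding projection. -/
def deformation : ModuleDeformation S E :=
  ModuleDeformation.ofAct L.act L.isFormal₂_act
    (fun x a => L.act_apply_zero _ _ |>.trans (by
      rw [formalConst_apply_zero]; exact congrArg (· • x) (formalConst_apply_zero a)))
    (fun x a b => L.act_act x a b)
    L.act_one

theorem deformation_act : L.deformation.act = L.act :=
  ModuleDeformation.ofAct_act _ _ _ _

/-- Every deformation of `E` is equivalent to the one constructed from the projection. -/
theorem isEquivOp_evalAct (D : ModuleDeformation S E) :
    L.deformation.IsEquivOp D (fun x => L.evalAct D (L.embed x)) where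
  formal := IsFormal.sum _ fun k => (D.isFormal₂_act.right _).comp (L.isFormal_embed k)
  apply_zero x := by
    -- At order zero the map is the reconstruction formula `∑ a k x • e k = x`.
    rw [evalAct, Finset.sum_apply]
    refine (Finset.sum_congr rfl fun k _ => ?_).trans (L.sum_smul x)
    refine (D.act_apply_zero _ _).trans ?_
    rw [embed_apply_zero, formalConst_apply_zero, formalConst_apply_zero]
  map_act x f := by
    rw [deformation_act]
    exact (congrArg (L.evalAct D) (L.embed_act x f)).trans (L.evalAct_mul D _ f)

/-- Both are equivalent to the deformation built from `P`, and equivalences can be inverted and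
composed. -/
theorem equivalent (L : ProjectiveLift S E ι) (D D' : ModuleDeformation S E) : D.Equivalent D' := by
  obtain ⟨U, hU, -⟩ := (L.isEquivOp_evalAct D).exists_inverse
  exact ⟨_, ((L.isEquivOp_evalAct D').comp hU).isEquivalence⟩

end ProjectiveLift

end Deformation

end

noncomputable section

/-! ### Hermitian deformations -/

section Nonneg

theorem FormalNonneg.zero : FormalNonneg 0 := ⟨fun _ => rfl, Or.inl rfl⟩

/-- The leading term of the sum is that of the summand of lower order, or the sum of two positive
numbers; nothing cancels. -/
theorem FormalNonneg.add {z w : ℕ → ℂ} (hz : FormalNonneg z) (hw : FormalNonneg w) :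
    FormalNonneg (z + w) := by
  refine ⟨fun n => by simp [hz.1 n, hw.1 n], ?_⟩
  rcases hz.2 with rfl | ⟨m, hm, hm'⟩
  · rw [zero_add]; exact hw.2
  rcases hw.2 with rfl | ⟨n, hn, hn'⟩
  · rw [add_zero]; exact hz.2
  right
  rcases lt_trichotomy m n with h | rfl | h
  · exact ⟨m, fun i hi => by simp [hm i hi, hn i (hi.trans h)], by simpa [hn m h] using hm'⟩
  · exact ⟨m, fun i hi => by simp [hm i hi, hn i hi], by simpa using add_pos hm' hn'⟩
  · exact ⟨n, fun i hi => by simp [hm i (hi.trans h), hn i hi], by simpa [hm n h] using hn'⟩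

theorem FormalNonneg.sum {ι : Type*} (s : Finset ι) {z : ι → ℕ → ℂ}
    (hz : ∀ i, FormalNonneg (z i)) : FormalNonneg (∑ i ∈ s, z i) := by
  classical
  induction s using Finset.induction_on with
  | empty => exact FormalNonneg.zero
  | insert i s hi ih => rw [Finset.sum_insert hi]; exact (hz i).add ih

end Nonneg

section Hermitian

open Matrix

variable {A : Type*} [CommRing A] [Algebra ℂ A] [StarRing A] {S : FormalDeformation ℂ A}
  {E : Type*} [AddCommGroup E] [Module ℂ E] [Module A E]

/-- A positive definite Hermitian `A`-valued inner product. -/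
structure IsInnerProduct (h₀ : E →ₗ⋆[ℂ] E →ₗ[ℂ] A) : Prop where
  star_apply : ∀ x y, star (h₀ x y) = h₀ y x
  smul_right : ∀ x (a : A) y, h₀ x (a • y) = a * h₀ x y
  definite : ∀ x, h₀ x x = 0 → x = 0

namespace HermitianModuleDeformation

variable {h₀ : E →ₗ⋆[ℂ] E →ₗ[ℂ] A}

/-- The inner product with values in the deformed algebra. -/
def innerAlg (D : HermitianModuleDeformation S h₀) (x y : ℕ → E) : S.Alg := D.inner x y

theorem isFormal₂_inner (D : HermitianModuleDeformation S h₀) :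
    IsFormal₂ (starRingEnd ℂ) D.inner :=
  isFormal₂_formalBilin D.h

theorem inner_formalConst (D : HermitianModuleDeformation S h₀) (x y : E) :
    D.inner (formalConst x) (formalConst y) = fun r => D.h r x y :=
  formalBilin_formalConst D.h x y

theorem star_innerAlg (D : HermitianModuleDeformation S h₀) (x y : ℕ → E) :
    star (D.innerAlg x y) = D.innerAlg y x :=
  D.h_star x y

theorem innerAlg_act (D : HermitianModuleDeformation S h₀) (x y : ℕ → E) (f : S.Alg) :
    D.innerAlg x (D.act y f) = D.innerAlg x y * f :=
  D.h_act x y f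

theorem innerAlg_act_left (hS : S.IsHermitian) (D : HermitianModuleDeformation S h₀)
    (x y : ℕ → E) (f : S.Alg) :
    D.innerAlg (D.act x f) y = star f * D.innerAlg x y := by
  let := hS.starRing
  rw [← star_innerAlg, innerAlg_act, star_mul, star_innerAlg]

theorem innerAlg_sum_right (D : HermitianModuleDeformation S h₀) {ι : Type*} (s : Finset ι)
    (x : ℕ → E) (y : ι → ℕ → E) :
    D.innerAlg x (∑ i ∈ s, y i) = ∑ i ∈ s, D.innerAlg x (y i) :=
  (D.isFormal₂_inner.right x).map_sum s y

theorem innerAlg_sum_left (D : HermitianModuleDeformation S h₀) {ι : Type*} (s : Finset ι)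
    (x : ι → ℕ → E) (y : ℕ → E) :
    D.innerAlg (∑ i ∈ s, x i) y = ∑ i ∈ s, D.innerAlg (x i) y :=
  (D.isFormal₂_inner.left y).map_sum s x

/-- An isometric equivalence, as an operator on formal power series. -/
structure IsIsometry (D D' : HermitianModuleDeformation S h₀) (T : (ℕ → E) → (ℕ → E)) : Prop
    extends D.toModuleDeformation.IsEquivOp D'.toModuleDeformation T where
  inner_map : ∀ x y, D'.inner (T x) (T y) = D.inner x y

namespace IsIsometry

variable {D D' D'' : HermitianModuleDeformation S h₀} {T U : (ℕ → E) → (ℕ → E)}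

theorem equivalent (hT : D.IsIsometry D' T) : D.Equivalent D' :=
  ⟨_, hT.toIsEquivOp.isEquivalence, fun x y => by
    rw [hT.formal.formalLin_coeff]; exact hT.inner_map x y⟩

theorem comp (hU : D'.IsIsometry D'' U) (hT : D.IsIsometry D' T) :
    D.IsIsometry D'' (fun x => U (T x)) :=
  ⟨hU.toIsEquivOp.comp hT.toIsEquivOp, fun x y => by rw [hU.inner_map, hT.inner_map]⟩

theorem exists_inverse (hT : D.IsIsometry D' T) : ∃ U, D'.IsIsometry D U := by
  obtain ⟨U, hU, hTU⟩ := hT.toIsEquivOp.exists_inverse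
  exact ⟨U, hU, fun x y => by rw [← hT.inner_map, hTU, hTU]⟩

end IsIsometry

end HermitianModuleDeformation

variable {h₀ : E →ₗ⋆[ℂ] E →ₗ[ℂ] A}

theorem isFormal_star [StarModule ℂ A] :
    IsFormal (X := A) (Y := A) (starRingEnd ℂ) (fun x => star x) where
  map_add := star_add
  map_smul c x := star_smul c x
  map_shift x := by ext n; cases n <;> simp

namespace ProjectiveLift

variable {ι : Type*} [Fintype ι] (L : ProjectiveLift S E ι)

/-- The inner product induced from the standard one of the free module. -/
def innerProd (x y : ℕ → E) : S.Alg := star (L.embed x) ⬝ᵥ L.embed y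

theorem innerProd_eq (x y : ℕ → E) :
    L.innerProd x y = ∑ k, star (L.embed x k) * L.embed y k := rfl

theorem innerProd_apply_zero (x y : ℕ → E) :
    (L.innerProd x y : ℕ → A) 0 = ∑ k, star (L.a k (x 0)) * L.a k (y 0) := by
  rw [innerProd_eq, FormalDeformation.Alg.sum_apply]
  refine Finset.sum_congr rfl fun k _ => (S.mul_apply_zero _ _).trans ?_
  exact congrArg₂ _ (congrArg star (L.embed_apply_zero x k)) (L.embed_apply_zero y k)

theorem star_innerProd (hS : S.IsHermitian) (x y : ℕ → E) :
    star (L.innerProd x y) = L.innerProd y x := by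
  let := hS.starRing
  simp only [innerProd_eq, star_sum, star_mul, star_star]

/-- Parseval's identity: the coordinates are inner products with the frame. Thus the lowest order of
the induced inner product is exactly `h₀`. -/
theorem sum_star_mul (h₀s : IsInnerProduct h₀) (ha : ∀ k x, L.a k x = h₀ (L.e k) x) (x y : E) :
    ∑ k, star (L.a k x) * L.a k y = h₀ x y := by
  conv_rhs => rw [← L.sum_smul y, map_sum]
  refine Finset.sum_congr rfl fun k _ => ?_
  rw [h₀s.smul_right, ha k x, h₀s.star_apply, mul_comm]

/-- Sesquilinearity over the deformed algebra moves all coefficients out of the inner product. Only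
the Gram matrix of the constant generators remains. -/
theorem innerAlg_evalAct (hS : S.IsHermitian) (D : HermitianModuleDeformation S h₀)
    (v w : ι → S.Alg) :
    D.innerAlg (L.evalAct D.toModuleDeformation v) (L.evalAct D.toModuleDeformation w) =
      star v ⬝ᵥ (Matrix.of fun i j => D.innerAlg (formalConst (L.e i)) (formalConst (L.e j))) *ᵥ w
      := by
  simp only [evalAct, D.innerAlg_sum_left, D.innerAlg_sum_right, D.innerAlg_act,
    D.innerAlg_act_left hS, dotProduct, mulVec, Finset.mul_sum, Matrix.of_apply, mul_assoc,
    Pi.star_apply]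

variable [IsScalarTower ℂ A E] [StarModule ℂ A]

theorem isFormal₂_innerProd : IsFormal₂ (Z := A) (starRingEnd ℂ) L.innerProd where
  left y := IsFormal.sum (Y := A) (V := fun k x => star (L.embed x k) * L.embed y k)
    Finset.univ fun k => (S.isFormal₂_mul.left _).comp (isFormal_star.comp (L.isFormal_embed k))
  right x := IsFormal.sum (Y := A) (V := fun k y => star (L.embed x k) * L.embed y k)
    Finset.univ fun k => S.isFormal_mul_left _ (L.isFormal_embed k)

/-- The Hermitian deformation of `(E, h₀)` defined by a deformation of the projection. -/
def hermitianDeformation (hS : S.IsHermitian) (h₀s : IsInnerProduct h₀)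
    (ha : ∀ k x, L.a k x = h₀ (L.e k) x) : HermitianModuleDeformation S h₀ where
  toModuleDeformation := L.deformation
  h := L.isFormal₂_innerProd.coeff
  h_zero := LinearMap.ext₂ fun x y => by
    refine (L.innerProd_apply_zero _ _).trans ?_
    rw [formalConst_apply_zero, formalConst_apply_zero]
    exact L.sum_star_mul h₀s ha x y
  h_star x y := by
    rw [L.isFormal₂_innerProd.formalBilin_coeff]
    exact L.star_innerProd hS x y
  h_act x y f := by
    rw [L.isFormal₂_innerProd.formalBilin_coeff, deformation_act]
    change L.innerProd x (L.act y f) = L.innerProd x y * (show S.Alg from f)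
    rw [innerProd_eq, innerProd_eq, Finset.sum_mul]
    refine Finset.sum_congr rfl fun k _ => ?_
    rw [mul_assoc]
    exact congrArg _ (congrFun (L.embed_act y f) k)
  -- `h(x, x)` is a sum of elements `b* ⋆ b`, on each of which a positive functional is nonnegative.
  h_pos x φ hφ := by
    rw [L.isFormal₂_innerProd.formalBilin_coeff]
    have := (isFormal_formalLin φ).map_sum Finset.univ
      (fun k => S.mul (star (L.embed x k : ℕ → A)) (L.embed x k))
    refine cast (congrArg FormalNonneg this.symm) (FormalNonneg.sum _ fun k => hφ (L.embed x k))
  h_definite x hx := by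
    rw [L.isFormal₂_innerProd.formalBilin_coeff] at hx
    -- If `x` starts at order `i`, the coefficient of `h(x, x)` at order `i + i` is `h₀ (x i) (x
    -- i)`; definiteness of `h₀` removes the coefficients one by one.
    have key : ∀ n, ∀ i < n, x i = 0 := by
      intro n
      induction n with
      | zero => intro i hi; omega
      | succ n ih =>
        intro i hi
        rcases Nat.lt_succ_iff_lt_or_eq.1 hi with hi | rfl
        · exact ih i hi
        · have h := L.isFormal₂_innerProd.apply_leading ih ih
          rw [hx] at h
          refine h₀s.definite _ ?_
          rw [← L.sum_star_mul h₀s ha, ← formalConst_apply_zero (x i), ← innerProd_apply_zero]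
          exact h.symm
    exact funext fun n => key (n + 1) n (by omega)

theorem hermitianDeformation_inner (hS : S.IsHermitian) (h₀s : IsInnerProduct h₀)
    (ha : ∀ k x, L.a k x = h₀ (L.e k) x) :
    (L.hermitianDeformation hS h₀s ha).inner = L.innerProd :=
  L.isFormal₂_innerProd.formalBilin_coeff

/-- The constructed Hermitian deformation is isometrically equivalent to every other one. -/
theorem exists_isIsometry [DecidableEq ι] (hS : S.IsHermitian) (h₀s : IsInnerProduct h₀)
    (ha : ∀ k x, L.a k x = h₀ (L.e k) x) (hP : L.P.conjTranspose = L.P)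
    (D : HermitianModuleDeformation S h₀) :
    ∃ T, (L.hermitianDeformation hS h₀s ha).IsIsometry D T := by
  let := hS.starRing
  have hv := S.isCompleteRingFiltration_matrix ι
  set H : Matrix ι ι S.Alg :=
    Matrix.of fun i j => D.innerAlg (formalConst (L.e i)) (formalConst (L.e j)) with hH
  have hHstar : H.conjTranspose = H := by
    ext i j : 2
    exact D.star_innerAlg _ _
  have hHP : H - L.P ∈ S.matrixFiltration ι 1 := fun i j => by
    rw [S.mem_filtration_one]
    change (D.inner (formalConst (L.e i)) (formalConst (L.e j)) 0 : A) - (L.P i j : ℕ → A) 0 = 0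
    rw [L.P_zero, D.inner_formalConst]
    change D.h 0 (L.e i) (L.e j) - L.a i (L.e j) = 0
    rw [D.h_zero, ha, sub_self]
  -- On the image of `P` this matrix represents the inner product of `D` pulled back by `evalAct`.
  -- The summand `1 - P` completes it to a Hermitian matrix near `1` that commutes with `P`.
  set X : Matrix ι ι S.Alg := 1 - L.P + L.P * H * L.P with hX
  have hX₁ : X - 1 ∈ S.matrixFiltration ι 1 := by
    have : X - 1 = L.P * (H - L.P) * L.P := by
      rw [mul_sub, sub_mul, L.idem, L.idem, hX]; abel
    rw [this]
    exact hv.mul_mem_right (hv.mul_mem_left _ hHP) _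
  have hXstar : X.conjTranspose = X := by
    simp only [hX, conjTranspose_add, conjTranspose_sub, conjTranspose_one, conjTranspose_mul, hP,
      hHstar, mul_assoc]
  have hPX : Commute L.P X := by
    have : L.P * X = L.P * H * L.P ∧ X * L.P = L.P * H * L.P := by
      constructor
      · rw [hX, mul_add, mul_sub, L.idem, mul_one, sub_self, zero_add, ← mul_assoc, ← mul_assoc,
          L.idem]
      · rw [hX, add_mul, sub_mul, L.idem, one_mul, sub_self, zero_add, mul_assoc, L.idem]
    exact this.1.trans this.2.symm
  obtain ⟨W, hW₁, hWX, hWc, hWσ⟩ := hv.exists_invSqrt hX₁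
  have hWstar : W.conjTranspose = W := hWσ _ (hS.isFilteredAntihom ι) hXstar
  have hXW : Commute X W := hWc X (Commute.refl X)
  have hPW : Commute L.P W := hWc _ hPX
  -- `W` is an inverse square root of `X`, so `V` is a square root. It is Hermitian and commutes
  -- with `P`, hence preserves the image of `P` and induces `U` on `E[[λ]]`.
  set V := W * X with hV
  have hVV : V * V = X := by
    rw [hV, mul_assoc, ← mul_assoc X, hXW.eq, ← mul_assoc, ← mul_assoc, hWX, one_mul]
  have hVstar : V.conjTranspose = V := by rw [hV, conjTranspose_mul, hWstar, hXstar, hXW.eq]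
  have hPV : L.P * V = V * L.P := (hPW.mul_right hPX).eq
  have hV₁ : V - 1 ∈ S.matrixFiltration ι 1 := by
    have : V - 1 = W * (X - 1) + (W - 1) := by rw [mul_sub, hV, mul_one]; abel
    rw [this]
    exact add_mem (hv.mul_mem_left _ hX₁) hW₁
  have hU : ∀ x, ∃ y, L.embed y = V *ᵥ L.embed x := fun x => L.exists_embed_eq (by
    rw [mulVec_mulVec, hPV, ← mulVec_mulVec, mulVec_embed])
  choose U hU using hU
  have hUequiv : L.deformation.IsEquivOp L.deformation U :=
    { formal := L.isFormal_of_embed fun k =>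
        (IsFormal.sum (Y := A) (V := fun j x => V k j * L.embed x j) Finset.univ fun j =>
          S.isFormal_mul_left _ (L.isFormal_embed j)).congr fun x => congrFun (hU x) k
      apply_zero := fun x => by
        have h : ∀ k, L.a k (U (formalConst x) 0) = L.a k x := fun k => by
          have h₁ : L.embed (U (formalConst x)) k - L.embed (formalConst x) k ∈ S.filtration 1 := by
            have : L.embed (U (formalConst x)) k - L.embed (formalConst x) k =
                ∑ j, (V - 1) k j * L.embed (formalConst x) j := by
              rw [hU]
              conv_lhs => rw [← one_mulVec (L.embed (formalConst x)), mulVec_mulVec, mul_one,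
                ← Pi.sub_apply, ← sub_mulVec]
              rfl
            rw [this]
            exact sum_mem fun j _ => S.isFormal₂_mul.apply_eq_zero (n := 0) (hV₁ k j)
              (fun i hi => by omega)
          have h₂ : (L.embed (U (formalConst x)) k : ℕ → A) 0 -
            (L.embed (formalConst x) k : ℕ → A) 0 = 0 := S.mem_filtration_one.1 h₁
          rwa [embed_apply_zero, embed_apply_zero, formalConst_apply_zero, sub_eq_zero] at h₂
        rw [← L.sum_smul (U (formalConst x) 0)]
        simp only [h]
        exact L.sum_smul x
      map_act := fun x f => by
        rw [deformation_act]
        refine L.embed_injective ?_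
        refine (hU _).trans ?_
        refine (congrArg (V *ᵥ ·) (L.embed_act x f)).trans ?_
        refine (mulVec_mul_right V _ _).trans ?_
        refine Eq.trans ?_ (L.embed_act (U x) f).symm
        rw [hU] }
  -- `V* V = X`, and `X` agrees with `P H P` on the image of `P`. So `U` and `evalAct` pull back the
  -- same inner product, and `evalAct` after the inverse of `U` is isometric.
  have hUinner : ∀ x y, L.innerProd (U x) (U y) =
      D.innerAlg (L.evalAct D.toModuleDeformation (L.embed x))
        (L.evalAct D.toModuleDeformation (L.embed y)) := fun x y => by
    rw [innerAlg_evalAct L hS, ← hH, innerProd, hU, hU, star_mulVec, hVstar, ← dotProduct_mulVec,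
      mulVec_mulVec, hVV]
    conv_rhs => rw [← L.mulVec_embed x, ← L.mulVec_embed y, star_mulVec, hP, ← dotProduct_mulVec,
      mulVec_mulVec, mulVec_mulVec]
    rw [hX, add_mulVec, sub_mulVec, one_mulVec, mulVec_embed, sub_self, zero_add]
  obtain ⟨U', hU', hUU'⟩ := hUequiv.exists_inverse
  refine ⟨_, (L.isEquivOp_evalAct D.toModuleDeformation).comp hU', fun x y => ?_⟩
  rw [hermitianDeformation_inner]
  refine (hUinner (U' x) (U' y)).symm.trans ?_
  rw [hUU', hUU']

theorem hermitian_equivalent [DecidableEq ι] (hS : S.IsHermitian) (h₀s : IsInnerProduct h₀)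
    (ha : ∀ k x, L.a k x = h₀ (L.e k) x) (hP : L.P.conjTranspose = L.P)
    (D D' : HermitianModuleDeformation S h₀) : D.Equivalent D' := by
  obtain ⟨T, hT⟩ := L.exists_isIsometry hS h₀s ha hP D
  obtain ⟨T', hT'⟩ := L.exists_isIsometry hS h₀s ha hP D'
  obtain ⟨U, hU⟩ := hT.exists_inverse
  exact (hT'.comp hU).equivalent

end ProjectiveLift

end Hermitian

end

noncomputable section

/-! ### Differential operators -/

namespace IsDiffOp

variable {A : Type*} [CommRing A] {X Y Z : Type*} [AddCommGroup X] [AddCommGroup Y]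
  [AddCommGroup Z] [Module A X] [Module A Y] [Module A Z]

theorem zero (k : ℕ) : IsDiffOp A k (fun _ : X => (0 : Y)) := by
  induction k with
  | zero => intro a x; simp
  | succ k ih => intro a; simpa using ih

theorem add {k : ℕ} {D D' : X → Y} (h : IsDiffOp A k D) (h' : IsDiffOp A k D') :
    IsDiffOp A k (fun x => D x + D' x) := by
  induction k generalizing D D' with
  | zero => intro a x; simp only [h a x, h' a x, smul_add]
  | succ k ih =>
    intro a
    convert ih (h a) (h' a) using 2 with x
    rw [smul_add]
    exact add_sub_add_comm _ _ _ _

theorem neg {k : ℕ} {D : X → Y} (h : IsDiffOp A k D) : IsDiffOp A k (fun x => -D x) := by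
  induction k generalizing D with
  | zero => intro a x; simp only [h a x, smul_neg]
  | succ k ih =>
    intro a
    convert ih (h a) using 2 with x
    rw [smul_neg, neg_sub, sub_neg_eq_add, neg_add_eq_sub]

theorem succ {k : ℕ} {D : X → Y} (h : IsDiffOp A k D) : IsDiffOp A (k + 1) D := by
  induction k generalizing D with
  | zero =>
    intro a
    convert zero (A := A) (X := X) (Y := Y) 0 using 2 with x
    rw [h a x, sub_self]
  | succ k ih => exact fun a => ih (h a)

theorem mono {k l : ℕ} {D : X → Y} (h : IsDiffOp A k D) (hkl : k ≤ l) : IsDiffOp A l D := by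
  induction l, hkl using Nat.le_induction with
  | base => exact h
  | succ l _ ih => exact ih.succ

/-- The Leibniz rule `[D D', a] = D [D', a] + [D, a] D'` lowers the total order by one in each
summand. Additivity of `D` is an extra hypothesis since `IsDiffOp` does not contain it. -/
theorem comp {k l : ℕ} {D : Y → Z} {D' : X → Y} (hadd : ∀ y y', D (y + y') = D y + D y')
    (h : IsDiffOp A k D) (h' : IsDiffOp A l D') : IsDiffOp A (k + l) (fun x => D (D' x)) := by
  generalize hn : k + l = n
  induction n generalizing k l D D' with
  | zero =>
    obtain ⟨rfl, rfl⟩ : k = 0 ∧ l = 0 := by omega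
    intro a x
    simp only [h' a x, h a]
  | succ n ih =>
    intro a
    have hsub : ∀ y y', D (y - y') = D y - D y' := fun y y' => by
      have := hadd (y - y') y'
      rw [sub_add_cancel] at this
      rw [this, add_sub_cancel_right]
    have h₁ : IsDiffOp A n (fun x => D (D' (a • x) - a • D' x)) := by
      cases l with
      | zero =>
        convert zero (A := A) (X := X) (Y := Z) n using 2 with x
        rw [h' a x, sub_self]
        simpa using hsub 0 0
      | succ l => exact ih hadd h (h' a) (by omega)
    have h₂ : IsDiffOp A n (fun x => D (a • D' x) - a • D (D' x)) := by
      cases k with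
      | zero =>
        convert zero (A := A) (X := X) (Y := Z) n using 2 with x
        rw [h a, sub_self]
      | succ k =>
        refine ih (D := fun y => D (a • y) - a • D y) (fun y y' => ?_) (h a) h' (by omega)
        rw [smul_add, hadd, hadd, smul_add]
        exact add_sub_add_comm _ _ _ _
    convert h₁.add h₂ using 2 with x
    rw [hsub]
    exact (sub_add_sub_cancel _ _ _).symm

theorem of_linearMap (f : X →ₗ[A] Y) : IsDiffOp A 0 f := fun a x => map_smul f a x

end IsDiffOp

/-! ### Classes of operators that contain the deformed structures -/

section OperatorClass

variable {A : Type*} [CommRing A] [Algebra ℂ A] {S : FormalDeformation ℂ A}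
  {E : Type*} [AddCommGroup E] [Module ℂ E] [Module A E] {ι : Type*} [Fintype ι]

/-- Classes of maps from `Z` to `A` and to `E`, indexed by the order in `λ`, which are stable under
the operations from which the deformation of a projective module is built. -/
structure OperatorClass (L : ProjectiveLift S E ι) (Z : Type*) where
  memA : ℕ → (Z → A) → Prop
  memE : ℕ → (Z → E) → Prop
  zeroA : ∀ n, memA n fun _ => 0
  addA : ∀ {n T U}, memA n T → memA n U → memA n fun z => T z + U z
  zeroE : ∀ n, memE n fun _ => 0
  addE : ∀ {n T U}, memE n T → memE n U → memE n fun z => T z + U z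
  negE : ∀ {n T}, memE n T → memE n fun z => -T z
  mono : ∀ {m n T}, memA m T → m ≤ n → memA n T
  coord : ∀ {n T} k, memE n T → memA n fun z => L.a k (T z)
  smul : ∀ {n T} k, memA n T → memE n fun z => T z • L.e k
  mul_left : ∀ {n T} r a, memA n T → memA (r + n) fun z => S.C r a (T z)
  mul_right : ∀ {n T} r b, memA n T → memA (r + n) fun z => S.C r (T z) b

namespace OperatorClass

variable {L : ProjectiveLift S E ι} {Z : Type*} (O : OperatorClass L Z)

theorem sumA {κ : Type*} (s : Finset κ) {n : ℕ} {T : κ → Z → A} (h : ∀ i ∈ s, O.memA n (T i)) :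
    O.memA n fun z => ∑ i ∈ s, T i z := by
  classical
  induction s using Finset.induction_on with
  | empty => simpa using O.zeroA n
  | insert i s hi ih =>
    simp only [Finset.sum_insert hi]
    exact O.addA (h i (by simp)) (ih fun j hj => h j (by simp [hj]))

theorem sumE {κ : Type*} (s : Finset κ) {n : ℕ} {T : κ → Z → E} (h : ∀ i ∈ s, O.memE n (T i)) :
    O.memE n fun z => ∑ i ∈ s, T i z := by
  classical
  induction s using Finset.induction_on with
  | empty => simpa using O.zeroE n
  | insert i s hi ih =>
    simp only [Finset.sum_insert hi]
    exact O.addE (h i (by simp)) (ih fun j hj => h j (by simp [hj]))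

/-- All coefficients of a family of elements of the deformed algebra belong to the class. -/
def AdmA (T : Z → S.Alg) : Prop := ∀ n, O.memA n fun z => (T z : ℕ → A) n

/-- All coefficients of a family of elements of `E[[λ]]` belong to the class. -/
def AdmE (T : Z → ℕ → E) : Prop := ∀ n, O.memE n fun z => T z n

variable {O}

theorem AdmA.mul_left {T : Z → S.Alg} (h : O.AdmA T) (a : S.Alg) : O.AdmA fun z => a * T z := by
  intro n
  change O.memA n fun z => ∑ p ∈ Finset.HasAntidiagonal.antidiagonal n,
    ∑ q ∈ Finset.HasAntidiagonal.antidiagonal p.2, S.C p.1 ((a : ℕ → A) q.1) ((T z : ℕ → A) q.2)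
  refine O.sumA _ fun p hp => O.sumA _ fun q hq => ?_
  rw [Finset.HasAntidiagonal.mem_antidiagonal] at hp hq
  exact O.mono (O.mul_left p.1 ((a : ℕ → A) q.1) (h q.2)) (by omega)

theorem AdmA.mul_right {T : Z → S.Alg} (h : O.AdmA T) (b : S.Alg) : O.AdmA fun z => T z * b := by
  intro n
  change O.memA n fun z => ∑ p ∈ Finset.HasAntidiagonal.antidiagonal n,
    ∑ q ∈ Finset.HasAntidiagonal.antidiagonal p.2, S.C p.1 ((T z : ℕ → A) q.1) ((b : ℕ → A) q.2)
  refine O.sumA _ fun p hp => O.sumA _ fun q hq => ?_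
  rw [Finset.HasAntidiagonal.mem_antidiagonal] at hp hq
  exact O.mono (O.mul_right p.1 ((b : ℕ → A) q.2) (h q.1)) (by omega)

theorem AdmA.sum {κ : Type*} (s : Finset κ) {T : κ → Z → S.Alg} (h : ∀ i, O.AdmA (T i)) :
    O.AdmA fun z => ∑ i ∈ s, T i z := by
  intro n
  simp only [FormalDeformation.Alg.sum_apply]
  exact O.sumA s fun i _ => h i n

theorem AdmE.embed {T : Z → ℕ → E} (h : O.AdmE T) (k : ι) : O.AdmA fun z => L.embed (T z) k :=
  AdmA.sum (T := fun j z => L.P k j * L.coords (T z) j) _ fun j =>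
    AdmA.mul_left (fun n => O.coord j (h n)) _

theorem AdmA.eval {T : Z → ι → S.Alg} (h : ∀ k, O.AdmA fun z => T z k) :
    O.AdmE fun z => L.eval (T z) := fun n =>
  O.sumE _ fun k _ => O.smul k (h k n)

/-- The composite of `embed` and `eval` is the identity modulo `λ`. So the `n`-th coefficient of `T
z` is that of its image under the composite, corrected by the image of the coefficients below `n`.
The correction stays in the class of index `n`, so no order is lost. -/
theorem AdmE.of_embed [IsScalarTower ℂ A E] {T : Z → ℕ → E}
    (h : ∀ k, O.AdmA fun z => L.embed (T z) k) : O.AdmE T := by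
  have hτ := AdmA.eval h
  have hf := L.isFormal_eval L.isFormal_embed
  intro n
  induction n using Nat.strong_induction_on with
  | _ n ih =>
    -- The truncation of `T z` below order `n` is in the class by induction; subtracting it leaves a
    -- series starting at order `n`.
    have htr : O.AdmE fun z i => if i < n then T z i else 0 := fun i => by
      by_cases hi : i < n
      · simpa [hi] using ih i hi
      · simpa [hi] using O.zeroE i
    have := O.addE (hτ n) (O.negE (AdmA.eval htr.embed n))
    refine cast (congrArg _ (funext fun z => ?_)) this
    set y : ℕ → E := fun i => if i < n then T z i else 0 with hy
    have hlt : ∀ i < n, (T z - y) i = 0 := fun i hi => by simp [hy, hi]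
    have h₁ := hf.apply_leading hlt
    rw [hf.map_sub, L.eval_embed_zero, formalConst_apply_zero] at h₁
    rw [← sub_eq_add_neg]
    refine h₁.trans ?_
    simp [hy]

theorem AdmE.formalConst {O : OperatorClass L E} (h : O.memE 0 fun x => x) :
    O.AdmE _root_.formalConst := fun n => by
  cases n with
  | zero => simpa using h
  | succ n => simpa using O.zeroE (n + 1)

theorem AdmA.formalConst {O : OperatorClass L A} (h : O.memA 0 fun a => a) :
    O.AdmA fun a => (_root_.formalConst a : ℕ → A) := fun n => by
  cases n with
  | zero => simpa using h
  | succ n => simpa using O.zeroA (n + 1)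

variable [IsScalarTower ℂ A E]

/-- After embedding, the action is right multiplication by `f` in the deformed algebra, an operation
under which the class is stable. -/
theorem memE_R_left (O : OperatorClass L E) (h : O.memE 0 fun x => x) (r : ℕ) (f : A) :
    O.memE r fun x => L.deformation.R r x f := by
  refine AdmE.of_embed (T := fun x => L.act (_root_.formalConst x) (_root_.formalConst f))
    (fun k => ?_) r
  refine cast (congrArg _ (funext fun x => (congrFun (L.embed_act _ _) k).symm))
    (((AdmE.formalConst h).embed k).mul_right (_root_.formalConst f : ℕ → A))

theorem memE_R_right (O : OperatorClass L A) (h : O.memA 0 fun a => a) (r : ℕ) (x : E) :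
    O.memE r fun f => L.deformation.R r x f := by
  refine AdmE.of_embed (T := fun f => L.act (_root_.formalConst x) (_root_.formalConst f))
    (fun k => ?_) r
  refine cast (congrArg _ (funext fun f => (congrFun (L.embed_act _ _) k).symm))
    ((AdmA.formalConst h).mul_left (L.embed (_root_.formalConst x) k))

theorem memA_h_right [StarRing A] [StarModule ℂ A] {h₀ : E →ₗ⋆[ℂ] E →ₗ[ℂ] A}
    (O : OperatorClass L E) (h : O.memE 0 fun x => x) (hS : S.IsHermitian)
    (h₀s : IsInnerProduct h₀) (ha : ∀ k x, L.a k x = h₀ (L.e k) x) (r : ℕ) (x : E) :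
    O.memA r fun y => (L.hermitianDeformation hS h₀s ha).h r x y :=
  AdmA.sum (T := fun k y => star (L.embed (_root_.formalConst x) k) *
    L.embed (_root_.formalConst y) k) Finset.univ
    (fun k => ((AdmE.formalConst h).embed k).mul_left _) r

end OperatorClass

/-- By this symmetry the type of an inner product has to be checked in the second argument only. -/
theorem HermitianModuleDeformation.star_h [StarRing A] {h₀ : E →ₗ⋆[ℂ] E →ₗ[ℂ] A}
    (D : HermitianModuleDeformation S h₀) (r : ℕ) (x y : E) : star (D.h r x y) = D.h r y x := by
  have h₁ := congrFun (D.inner_formalConst x y) r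
  have h₂ := congrFun (D.inner_formalConst y x) r
  rw [← h₁, ← h₂]
  exact congrFun (D.h_star (formalConst x) (formalConst y)) r

/-- Differential operators whose order is bounded in terms of the order in `λ`. -/
def diffOperatorClass (L : ProjectiveLift S E ι) (Z : Type*) [AddCommGroup Z] [Module A Z]
    {k b : ℕ → ℕ} (hS : ∀ r, IsBidiff A (k r) fun a b => S.C r a b) (hb : Monotone b)
    (hkb : ∀ r n, k r + b n ≤ b (r + n)) : OperatorClass L Z where
  memA n T := IsDiffOp A (b n) T
  memE n T := IsDiffOp A (b n) T
  zeroA _ := IsDiffOp.zero _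
  addA := IsDiffOp.add
  zeroE _ := IsDiffOp.zero _
  addE := IsDiffOp.add
  negE := IsDiffOp.neg
  mono h hmn := h.mono (hb hmn)
  coord := fun {n _} k h => by
    have := (IsDiffOp.of_linearMap (L.a k)).comp (map_add (L.a k)) h
    rwa [zero_add] at this
  smul := fun {n _} k h => by
    have := (IsDiffOp.of_linearMap (LinearMap.toSpanSingleton A E (L.e k))).comp (map_add _) h
    rwa [zero_add] at this
  mul_left r a h := (((hS r).2 a).comp (map_add (S.C r a)) h).mono (hkb r _)
  mul_right r b h :=
    (((hS r).1 b).comp (fun y y' => LinearMap.map_add₂ (S.C r) y y' b) h).mono (hkb r _)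

/-- Bounds for the orders of the operators that are composed of the coefficients of a differential
deformation. -/
theorem FormalDeformation.exists_orderBound
    (hS : ∀ r, ∃ k, IsBidiff A k fun a b => S.C r a b) :
    ∃ k b : ℕ → ℕ, (∀ r, IsBidiff A (k r) fun a b => S.C r a b) ∧ Monotone b ∧
      ∀ r n, k r + b n ≤ b (r + n) := by
  choose k hk using hS
  have hle : ∀ {m n}, m ≤ n → (Finset.range (m + 1)).sup k ≤ (Finset.range (n + 1)).sup k :=
    fun h => Finset.sup_mono (Finset.range_mono (by omega))
  -- The factor `r` makes the bound `0` at `r = 0`, as the inequality there forces, and `C 0` does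
  -- have order zero. For `r ≥ 1` it only enlarges `k r`. The factor `n` beside a running maximum
  -- gives superadditivity.
  refine ⟨fun r => r * k r, fun n => n * (Finset.range (n + 1)).sup k, fun r => ?_,
    fun m n h => Nat.mul_le_mul h (hle h), fun r n => ?_⟩
  · cases r with
    | zero =>
      simp only [S.C_zero, zero_mul]
      exact ⟨fun b a x => smul_mul_assoc a x b, fun c a x => mul_smul_comm a c x⟩
    | succ r =>
      have hr : k (r + 1) ≤ (r + 1) * k (r + 1) := Nat.le_mul_of_pos_left _ r.succ_pos
      exact ⟨fun b => ((hk (r + 1)).1 b).mono hr, fun a => ((hk (r + 1)).2 a).mono hr⟩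
  · beta_reduce
    rw [add_mul]
    refine add_le_add (Nat.mul_le_mul_left r ?_) (Nat.mul_le_mul_left n (hle (by omega)))
    exact Finset.le_sup (f := k) (Finset.mem_range.2 (by omega))

theorem isDiffOp_id (A X : Type*) [CommRing A] [AddCommGroup X] [Module A X] :
    IsDiffOp A 0 fun x : X => x := fun _ _ => rfl

end OperatorClass

end

noncomputable section

/-! ### Finitely many sections span every fiber -/

section Geometry

variable {d : ℕ} {M : Type*} [TopologicalSpace M] [ChartedSpace (EuclideanSpace ℝ (Fin d)) M]
  {F : Type*} [NormedAddCommGroup F] [NormedSpace ℂ F]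
  {V : M → Type*} [TopologicalSpace (TotalSpace F V)] [∀ p, AddCommGroup (V p)]
  [∀ p, Module ℂ (V p)] [∀ p, TopologicalSpace (V p)] [FiberBundle F V] [VectorBundle ℂ F V]

/-- The sections `s i` span every fiber: no nonzero functional vanishes on all of them. -/
def SpansFibers {ι : Type*} (s : ι → smoothSections d F V) : Prop :=
  ∀ p (ψ : V p →ₗ[ℂ] ℂ), (∀ i, ψ ((s i).1 p) = 0) → ψ = 0

section

variable [IsManifold (𝓡 d) ∞ M] [ContMDiffVectorBundle ∞ F V (𝓡 d)] [FiniteDimensional ℂ F]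

/-- Second countability reduces the trivializations to countably many. Their local frames, cut off
by a subordinate partition of unity, span wherever the cutoff is nonzero. The frames are real bases,
which still determine a complex functional. -/
theorem exists_locallyFinite_spansFibers [T2Space M] [SecondCountableTopology M] :
    ∃ t : ℕ → smoothSections d F V, LocallyFinite (fun n => {p | (t n).1 p ≠ 0}) ∧
      SpansFibers t := by
  have : LocallyCompactSpace M := ChartedSpace.locallyCompactSpace (EuclideanSpace ℝ (Fin d)) M
  obtain ⟨C, hC, hCc⟩ := TopologicalSpace.countable_cover_nhds
    (f := fun q : M => (trivializationAt F V q).baseSet)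
    (fun q => (trivializationAt F V q).open_baseSet.mem_nhds (mem_baseSet_trivializationAt F V q))
  have := hC.to_subtype
  obtain ⟨ρ, hρ⟩ := SmoothPartitionOfUnity.exists_isSubordinate (𝓡 d) (isClosed_univ (X := M))
    (fun q : C => (trivializationAt F V (q : M)).baseSet)
    (fun q => (trivializationAt F V (q : M)).open_baseSet)
    (by rw [← hCc, Set.iUnion_subtype])
  let b := Module.finBasis ℝ F
  let t : C × Fin (Module.finrank ℝ F) → smoothSections d F V := fun i =>
    ⟨fun p => ρ i.1 p • (trivializationAt F V (i.1 : M)).localFrame b i.2 p,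
      ContMDiffOn.smul_section_of_tsupport (V := V) (ρ i.1).contMDiff.contMDiffOn
        (trivializationAt F V (i.1 : M)).open_baseSet (hρ i.1)
        ((trivializationAt F V (i.1 : M)).contMDiffOn_localFrame_baseSet ∞ b i.2)⟩
  obtain ⟨f, hf⟩ := Countable.exists_injective_nat (C × Fin (Module.finrank ℝ F))
  -- Indices outside the range of the enumeration carry the zero section.
  refine ⟨Function.extend f t 0, fun p => ?_, fun p ψ hψ => ?_⟩
  · obtain ⟨U, hU, hfin⟩ := ρ.locallyFinite p
    refine ⟨U, hU, ((hfin.prod (Set.finite_univ (α := Fin (Module.finrank ℝ F)))).image f).subset ?_⟩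
    rintro n ⟨q, hq, hqU⟩
    by_cases hn : ∃ i, f i = n
    · obtain ⟨i, rfl⟩ := hn
      rw [Set.mem_ofPred_eq, hf.extend_apply] at hq
      refine ⟨i, ⟨⟨q, ?_, hqU⟩, trivial⟩, rfl⟩
      intro h
      exact hq (by simp only [t]; rw [h, zero_smul])
    · rw [Set.mem_ofPred_eq, Function.extend_apply' _ _ _ hn] at hq
      exact absurd rfl hq
  · obtain ⟨c, hc⟩ := ρ.exists_pos_of_mem (Set.mem_univ p)
    have hp : p ∈ (trivializationAt F V (c : M)).baseSet :=
      hρ c (subset_tsupport _ hc.ne')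
    have hψ' : ∀ j, (ψ.restrictScalars ℝ)
        ((trivializationAt F V (c : M)).basisAt b hp j) = 0 := fun j => by
      have h := hψ (f (c, j))
      rw [hf.extend_apply] at h
      have h' : (ψ.restrictScalars ℝ) (ρ c p •
          (trivializationAt F V (c : M)).localFrame b j p) = 0 := h
      rw [map_smul, smul_eq_zero, Trivialization.localFrame_apply_of_mem_baseSet _ _ hp] at h'
      exact h'.resolve_left hc.ne'
    have h0 : ψ.restrictScalars ℝ = 0 :=
      ((trivializationAt F V (c : M)).basisAt b hp).ext fun j => by
        rw [hψ' j, LinearMap.zero_apply]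
    ext v
    exact LinearMap.congr_fun h0 v

/-- Fewer parameters than values: some point is not a value of the tuple `s` of sections,
considered as functions on the dual bundle. -/
theorem exists_forall_dual_ne [SecondCountableTopology M] {m : ℕ}
    (hm : Module.finrank ℝ (EuclideanSpace ℝ (Fin d) × (F →L[ℂ] ℂ)) <
      Module.finrank ℝ (Fin m → ℂ)) (s : Fin m → smoothSections d F V) :
    ∃ c : Fin m → ℂ, ∀ p (ψ : V p →ₗ[ℂ] ℂ), ∃ i, ψ ((s i).1 p) ≠ c i := by
  have : FiniteDimensional ℝ (F →L[ℂ] ℂ) := FiniteDimensional.complexToReal _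
  -- The map `(p, ψ) ↦ (ψ (s i p))ᵢ` on the dual bundle, written in the chart and the trivialization
  -- at `q`.
  let f : M → EuclideanSpace ℝ (Fin d) × (F →L[ℂ] ℂ) → Fin m → ℂ := fun q z i =>
    z.2 ((trivializationAt F V q ⟨(chartAt _ q).symm z.1, (s i).1 ((chartAt _ q).symm z.1)⟩).2)
  -- Balls in the chart are used because the bound on the Hausdorff dimension of a `C¹` image is
  -- applied on convex sets.
  have hf : ∀ q : M, ∃ B : Set (EuclideanSpace ℝ (Fin d)), Convex ℝ B ∧
      ContDiffOn ℝ 1 (f q) (B ×ˢ Set.univ) ∧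
      {p | p ∈ (chartAt (EuclideanSpace ℝ (Fin d)) q).source ∧ chartAt _ q p ∈ B ∧
        p ∈ (trivializationAt F V q).baseSet} ∈ nhds q := by
    intro q
    set φ := chartAt (EuclideanSpace ℝ (Fin d)) q
    set e := trivializationAt F V q
    have hO : IsOpen (φ.target ∩ φ.symm ⁻¹' e.baseSet) :=
      φ.isOpen_inter_preimage_symm e.open_baseSet
    obtain ⟨r, hr, hrO⟩ := Metric.isOpen_iff.1 hO (φ q) ⟨mem_chart_target _ q, by
      rw [Set.mem_preimage, φ.left_inv (mem_chart_source _ q)]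
      exact mem_baseSet_trivializationAt F V q⟩
    refine ⟨Metric.ball (φ q) r, convex_ball _ _, ?_, ?_⟩
    · refine contDiffOn_pi.2 fun i => ?_
      have h₁ : ContMDiffOn (𝓡 d) 𝓘(ℝ, F) ∞ (fun p => (e ⟨p, (s i).1 p⟩).2) e.baseSet :=
        (e.contMDiffOn_section_baseSet_iff).1 (s i).2.contMDiffOn
      have h₂ : ContMDiffOn (𝓡 d) 𝓘(ℝ, F) ∞ (fun x => (e ⟨φ.symm x, (s i).1 (φ.symm x)⟩).2)
          (Metric.ball (φ q) r) :=
        h₁.comp (contMDiffOn_chart_symm.mono fun x hx => (hrO hx).1) fun x hx => (hrO hx).2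
      have h₃ := (contMDiffOn_iff_contDiffOn.1 h₂).of_le (m := 1) (by simp)
      exact ((ContinuousLinearMap.restrictScalarsL ℂ F ℂ ℝ ℝ).contDiff.comp
        contDiff_snd).contDiffOn.clm_apply
          (h₃.comp (contDiff_fst (E := EuclideanSpace ℝ (Fin d)) (F := F →L[ℂ] ℂ)).contDiffOn
            fun z hz => hz.1)
    · filter_upwards [φ.open_source.mem_nhds (mem_chart_source _ q),
        (φ.continuousAt (mem_chart_source _ q)).preimage_mem_nhds (Metric.ball_mem_nhds _ hr),
        e.open_baseSet.mem_nhds (mem_baseSet_trivializationAt F V q)] with p h₁ h₂ h₃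
      exact ⟨h₁, h₂, h₃⟩
  choose B hB hfB hBn using hf
  obtain ⟨C, hC, hCc⟩ := TopologicalSpace.countable_cover_nhds hBn
  -- Countably many pieces cover the dual bundle, and none has an image of dimension above that of
  -- the source. The complement of the union is therefore dense.
  have hdim : dimH (⋃ q ∈ C, f q '' (B q ×ˢ Set.univ)) < Module.finrank ℝ (Fin m → ℂ) := by
    refine lt_of_le_of_lt ?_ (Nat.cast_lt.2 hm)
    rw [dimH_bUnion hC]
    refine iSup₂_le fun q _ => ((hfB q).dimH_image_le ((hB q).prod convex_univ) le_rfl).trans ?_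
    rw [← Real.dimH_univ_eq_finrank]
    exact dimH_mono (Set.subset_univ _)
  obtain ⟨c, hc⟩ := (dense_compl_of_dimH_lt_finrank hdim).nonempty
  refine ⟨c, fun p ψ => ?_⟩
  by_contra! h
  obtain ⟨q, hq, hp₁, hp₂, hp₃⟩ : ∃ q ∈ C, p ∈ {p | p ∈ (chartAt (EuclideanSpace ℝ (Fin d))
      q).source ∧ chartAt _ q p ∈ B q ∧ p ∈ (trivializationAt F V q).baseSet} := by
    simpa only [Set.mem_iUnion₂, exists_prop] using hCc.ge (Set.mem_univ p)
  refine hc (Set.mem_biUnion hq ⟨(chartAt _ q p,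
    (ψ ∘ₗ (trivializationAt F V q).symmₗ ℂ p).toContinuousLinearMap), ⟨hp₂, trivial⟩, ?_⟩)
  ext i
  rw [← h i]
  simp only [f, LinearMap.coe_toContinuousLinearMap', LinearMap.comp_apply]
  rw [(chartAt _ q).left_inv hp₁]
  refine congrArg ψ ?_
  rw [Trivialization.symmₗ_apply _ hp₃]
  exact Trivialization.symm_apply_apply_mk _ hp₃ _

/-- The sections `t k` are absorbed one at a time into an `m`-tuple, `σ (k + 1) = σ k - c t k`, with
`c` not a value of `σ k` on the dual bundle. If `ψ` kills `σ (k + 1)`, then `ψ (σ k) = c ψ (t k)`.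
When `ψ (t k) ≠ 0`, rescaling `ψ` would make `c` a value, so `ψ` kills `t k` and hence `σ k`. Local
finiteness makes the limit tuple smooth. -/
theorem exists_finite_spansFibers [T2Space M] [SecondCountableTopology M] :
    ∃ (m : ℕ) (s : Fin m → smoothSections d F V), SpansFibers s := by
  obtain ⟨t, ht, hspan⟩ := exists_locallyFinite_spansFibers (d := d) (F := F) (V := V)
  -- The real dimension `2m` of the target then exceeds that of the total space of the dual bundle.
  set m := Module.finrank ℝ (EuclideanSpace ℝ (Fin d) × (F →L[ℂ] ℂ)) + 1 with hm
  choose c hc using exists_forall_dual_ne (d := d) (F := F) (V := V) (m := m) (by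
    rw [finrank_real_of_complex, Module.finrank_fin_fun]; omega)
  let σ : ℕ → Fin m → smoothSections d F V :=
    fun k => Nat.rec 0 (fun k s i => s i - c s i • t k) k
  have hσ : ∀ k i, σ (k + 1) i = σ k i - c (σ k) i • t k := fun k i => rfl
  have hσsum : ∀ k i, σ k i = ∑ j ∈ Finset.range k, -(c (σ j) i • t j) := fun k i => by
    induction k with
    | zero => rfl
    | succ k ih => rw [hσ, ih, Finset.sum_range_succ, sub_eq_add_neg]
  have key : ∀ k p (ψ : V p →ₗ[ℂ] ℂ), (∀ i, ψ ((σ k i).1 p) = 0) → ∀ j < k, ψ ((t j).1 p) = 0 := by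
    intro k
    induction k with
    | zero => intro p ψ _ j hj; omega
    | succ k ih =>
      intro p ψ h
      have h' : ∀ i, ψ ((σ k i).1 p) = c (σ k) i * ψ ((t k).1 p) := fun i => by
        have h₁ : ψ ((σ k i).1 p - c (σ k) i • (t k).1 p) = 0 := h i
        rwa [map_sub, map_smul, smul_eq_mul, sub_eq_zero] at h₁
      have hk : ψ ((t k).1 p) = 0 := by
        by_contra hne
        obtain ⟨i, hi⟩ := hc (σ k) p ((ψ ((t k).1 p))⁻¹ • ψ)
        refine hi ?_
        rw [LinearMap.smul_apply, h', smul_eq_mul, mul_comm, mul_assoc, mul_inv_cancel₀ hne,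
          mul_one]
      intro j hj
      rcases Nat.lt_succ_iff_lt_or_eq.1 hj with hj | rfl
      · exact ih p ψ (fun i => by rw [h' i, hk, mul_zero]) j hj
      · exact hk
  have hfin : ∀ i, LocallyFinite fun n => {p | (-(c (σ n) i • t n)).1 p ≠ 0} := fun i =>
    ht.subset fun n p hp h => hp (by
      change -(c (σ n) i • (t n).1 p) = 0
      rw [h, smul_zero, neg_zero])
  refine ⟨m, fun i => ⟨fun p => ∑ᶠ n, (-(c (σ n) i • t n)).1 p,
    ContMDiff.finsum_section_of_locallyFinite (hfin i) fun n => (-(c (σ n) i • t n)).2⟩,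
    fun p ψ hψ => hspan p ψ fun j => ?_⟩
  -- No `t n` with `n > K` contributes at `p`, so the limit there equals every later `σ`; the stage
  -- must also exceed `j` for `key` to reach `t j`.
  obtain ⟨K, hK⟩ := (ht.point_finite p).bddAbove
  refine key (max (K + 1) (j + 1)) p ψ (fun i => ?_) j (by omega)
  rw [← hψ i]
  refine congrArg ψ ?_
  refine Eq.trans ?_ (finsum_eq_sum_of_support_subset (s := Finset.range (max (K + 1) (j + 1))) _
    fun n hn => ?_).symm
  · rw [hσsum, Submodule.coe_sum, Finset.sum_apply]
  · have : n ≤ K := hK (by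
      intro h
      refine hn ?_
      change -(c (σ n) i • (t n).1 p) = 0
      rw [h, smul_zero, neg_zero])
    simp only [Finset.coe_range, Set.mem_Iio]
    omega

end

end Geometry

end

noncomputable section

/-! ### Gram matrices -/

section Gram

open Matrix

variable {W : Type*} [AddCommGroup W] [Module ℂ W]

/-- The Gram matrix of a family of vectors. -/
def gramMatrix {R N : Type*} {κ : Type*} (f : N → N → R) (u : κ → N) : Matrix κ κ R :=
  Matrix.of fun a b => f (u a) (u b)

variable {f : W →ₗ⋆[ℂ] W →ₗ[ℂ] ℂ}

theorem linearIndependent_of_det_gramMatrix_ne_zero {κ : Type*} [Fintype κ] [DecidableEq κ]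
    {u : κ → W} (h : (gramMatrix (fun v w => f v w) u).det ≠ 0) : LinearIndependent ℂ u := by
  rw [Fintype.linearIndependent_iff]
  intro c hc
  by_contra! hne
  refine h (Matrix.exists_mulVec_eq_zero_iff.1 ⟨c, fun h0 => ?_, ?_⟩)
  · obtain ⟨i, hi⟩ := hne
    exact hi (congrFun h0 i)
  · ext a
    have := congrArg (f (u a)) hc
    simpa [gramMatrix, mulVec, dotProduct, mul_comm] using this

/-- A kernel vector of the Gram matrix gives a linear combination orthogonal to every `u a`, hence
to itself. -/
theorem det_gramMatrix_ne_zero (hf : ∀ v, f v v = 0 → v = 0) {κ : Type*} [Fintype κ]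
    [DecidableEq κ] {u : κ → W} (hu : LinearIndependent ℂ u) :
    (gramMatrix (fun v w => f v w) u).det ≠ 0 := by
  intro h
  obtain ⟨c, hc, h0⟩ := Matrix.exists_mulVec_eq_zero_iff.2 h
  refine hc (funext fun i => Fintype.linearIndependent_iff.1 hu c (hf _ ?_) i)
  rw [LinearMap.map_sum₂]
  refine Finset.sum_eq_zero fun a _ => ?_
  have h₁ : f (u a) (∑ i, c i • u i) = 0 := by
    rw [map_sum]
    refine Eq.trans (Finset.sum_congr rfl fun b _ => ?_) (congrFun h0 a)
    rw [map_smul, smul_eq_mul, mul_comm]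
    rfl
  rw [LinearMap.map_smulₛₗ₂, h₁, smul_zero]

/-- Cramer's rule for the expansion of `x` in the basis `u`, with the denominator cleared so that
all coefficients are polynomial in the Gram entries and thus smooth in families. -/
theorem det_gramMatrix_smul [FiniteDimensional ℂ W] {r : ℕ} (hr : Module.finrank ℂ W = r)
    {u : Fin r → W}
    (h : (gramMatrix (fun v w => f v w) u).det ≠ 0) (x : W) :
    ∑ a, (∑ b, (gramMatrix (fun v w => f v w) u).adjugate a b * f (u b) x) • u a =
      (gramMatrix (fun v w => f v w) u).det • x := by
  have hu := linearIndependent_of_det_gramMatrix_ne_zero h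
  set G := gramMatrix (fun v w => f v w) u with hG
  let T : W →ₗ[ℂ] W := ∑ a, ∑ b, (G.adjugate a b • f (u b)).smulRight (u a)
  have hT : ∀ x, T x = ∑ a, (∑ b, G.adjugate a b * f (u b) x) • u a := fun x => by
    simp [T, Finset.sum_smul]
  rw [← hT]
  have : T = G.det • LinearMap.id := by
    let b := basisOfLinearIndependentOfCardEqFinrank' u hu (by simp [hr])
    refine b.ext fun c => ?_
    have hbc : b c = u c := by simp [b]
    rw [hbc, hT, LinearMap.smul_apply, LinearMap.id_apply]
    have key : ∀ a, ∑ b, G.adjugate a b * f (u b) (u c) = if a = c then G.det else 0 := fun a => by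
      have := congrFun (congrFun (Matrix.adjugate_mul G) a) c
      rw [Matrix.mul_apply] at this
      rw [hG] at this ⊢
      simp only [gramMatrix, Matrix.of_apply] at this ⊢
      rw [this, Matrix.smul_apply, Matrix.one_apply]
      simp
    simp [key]
  rw [this, LinearMap.smul_apply, LinearMap.id_apply]

/-- A spanning family contains a basis, and a definite form has an invertible Gram matrix on it. -/
theorem exists_det_gramMatrix_ne_zero [FiniteDimensional ℂ W] {r : ℕ}
    (hr : Module.finrank ℂ W = r) (hf : ∀ v, f v v = 0 → v = 0)
    {ι : Type*} {u : ι → W} (hu : ∀ ψ : W →ₗ[ℂ] ℂ, (∀ i, ψ (u i) = 0) → ψ = 0) :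
    ∃ j : Fin r → ι, (gramMatrix (fun v w => f v w) (u ∘ j)).det ≠ 0 := by
  subst hr
  have hspan : Submodule.span ℂ (Set.range u) = ⊤ := by
    by_contra h
    obtain ⟨ψ, hψ, hle⟩ := Submodule.exists_le_ker_of_lt_top _ (lt_top_iff_ne_top.2 h)
    exact hψ (hu ψ fun i => hle (Submodule.subset_span ⟨i, rfl⟩))
  obtain ⟨κ, a, -, ha, hli⟩ := exists_linearIndependent' ℂ u
  let b := Module.Basis.mk hli (by rw [ha, hspan])
  let e := (Module.finBasis ℂ W).indexEquiv b
  refine ⟨a ∘ e, det_gramMatrix_ne_zero hf ?_⟩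
  exact hli.comp e e.injective

end Gram

/-! ### Smooth functions -/

section SmoothFunctions

variable {d : ℕ} {M : Type*} [TopologicalSpace M] [ChartedSpace (EuclideanSpace ℝ (Fin d)) M]

theorem smoothFunctions_sum_apply {ι : Type*} (s : Finset ι) (f : ι → smoothFunctions d M) (p : M) :
    (∑ i ∈ s, f i).1 p = ∑ i ∈ s, (f i).1 p := by
  rw [← Finset.sum_apply]
  exact congrFun (map_sum (smoothFunctions d M).subtype f s) p

/-- Evaluation of smooth functions at a point. -/
def smoothEval (p : M) : smoothFunctions d M →+* ℂ :=
  (Pi.evalRingHom (fun _ : M => ℂ) p).comp (smoothFunctions d M).subtype.toRingHom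

/-- A positive smooth function has a smooth inverse square root. -/
theorem exists_smooth_invSqrt (f : smoothFunctions d M) (hf : star f = f)
    (hpos : ∀ p, 0 < (f.1 p).re) : ∃ u : smoothFunctions d M, star u = u ∧ u * u * f = 1 := by
  refine ⟨⟨fun p => (((Real.sqrt (f.1 p).re)⁻¹ : ℝ) : ℂ), fun p => ?_⟩, ?_, ?_⟩
  · have h₁ : ContMDiffAt (𝓡 d) 𝓘(ℝ, ℝ) ∞ (fun q => (f.1 q).re) p :=
      (Complex.reCLM.contMDiff.comp f.2) p
    have h₂ : ContDiffAt ℝ ∞ (fun x : ℝ => (((Real.sqrt x)⁻¹ : ℝ) : ℂ)) (f.1 p).re :=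
      Complex.ofRealCLM.contDiff.contDiffAt.comp _
        ((Real.contDiffAt_sqrt (hpos p).ne').inv (Real.sqrt_pos.2 (hpos p)).ne')
    exact h₂.contMDiffAt.comp p h₁
  · ext p
    exact Complex.conj_ofReal _
  · ext p
    have hre : f.1 p = ((f.1 p).re : ℂ) := by
      have := congrFun (congrArg Subtype.val hf) p
      exact (Complex.conj_eq_iff_re.1 this).symm
    have hs : Real.sqrt (f.1 p).re ≠ 0 := (Real.sqrt_pos.2 (hpos p)).ne'
    change (((Real.sqrt (f.1 p).re)⁻¹ : ℝ) : ℂ) * (((Real.sqrt (f.1 p).re)⁻¹ : ℝ) : ℂ) * f.1 p = 1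
    conv_lhs => rw [hre]
    norm_cast
    have h := Real.mul_self_sqrt (hpos p).le
    field_simp
    rw [pow_two]; exact h.symm

/-- A Hermitian matrix of smooth functions that is positive definite at each point. -/
structure IsSmoothPosDef {n : ℕ} (H : Fin n → Fin n → smoothFunctions d M) : Prop where
  star_apply : ∀ i j, star (H i j) = H j i
  pos : ∀ p (v : Fin n → ℂ), v ≠ 0 → 0 < (∑ i, ∑ j, star (v i) * (H i j).1 p * v j).re

/-- Smooth positive definite matrices have a smooth Cholesky decomposition. -/
theorem IsSmoothPosDef.exists_cholesky {n : ℕ} {H : Fin n → Fin n → smoothFunctions d M}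
    (hH : IsSmoothPosDef H) :
    ∃ l : Fin n → Fin n → smoothFunctions d M, ∀ i j, H i j = ∑ k, star (l k i) * l k j := by
  induction n with
  | zero => exact ⟨fun _ _ => 0, fun i => i.elim0⟩
  | succ n ih =>
    have h00 : ∀ p, 0 < ((H 0 0).1 p).re := fun p => by
      have := hH.pos p (Pi.single 0 1) (by simp)
      simpa [Fin.sum_univ_succ] using this
    obtain ⟨u, hu, huH⟩ := exists_smooth_invSqrt (H 0 0) (hH.star_apply 0 0) h00
    have hup : ∀ p, u.1 p * u.1 p * (H 0 0).1 p = 1 := fun p =>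
      congrFun (congrArg Subtype.val huH) p
    have hup' : ∀ p, star (u.1 p) = u.1 p := fun p => congrFun (congrArg Subtype.val hu) p
    have hHp : ∀ p i j, star ((H i j).1 p) = (H j i).1 p := fun p i j =>
      congrFun (congrArg Subtype.val (hH.star_apply i j)) p
    -- Elimination of the first variable: this is the Schur complement, since `u * u` is the inverse
    -- of `H 0 0`.
    obtain ⟨l, hl⟩ := ih (H := fun i j => H i.succ j.succ - H i.succ 0 * (u * u) * H 0 j.succ)
      { star_apply := fun i j => by
          simp only [star_sub, star_mul, hH.star_apply, hu]
          ring
        pos := fun p v hv => by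
          set b : ℂ := ∑ j, (H 0 (Fin.succ j)).1 p * v j with hb
          have hb' : star b = ∑ i, star (v i) * (H (Fin.succ i) 0).1 p := by
            rw [hb, star_sum]
            exact Finset.sum_congr rfl fun i _ => by rw [star_mul, hHp]
          -- The first entry minimizes the form for given `v`; the minimum is the value of the Schur
          -- complement at `v`.
          have := hH.pos p (Fin.cons (-(u.1 p * u.1 p * b)) v) (fun h0 => hv (funext fun i => by
            simpa using congrFun h0 i.succ))
          convert this using 2
          have e₁ : ∑ i, ∑ j, star (v i) * (H (Fin.succ i) (Fin.succ j) -
              H (Fin.succ i) 0 * (u * u) * H 0 (Fin.succ j)).1 p * v j =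
              ∑ i, ∑ j, star (v i) * (H (Fin.succ i) (Fin.succ j)).1 p * v j -
                star b * (u.1 p * u.1 p) * b := by
            rw [hb', hb, Finset.sum_mul, Finset.sum_mul_sum, ← Finset.sum_sub_distrib]
            refine Finset.sum_congr rfl fun i _ => ?_
            rw [← Finset.sum_sub_distrib]
            refine Finset.sum_congr rfl fun j _ => ?_
            change star (v i) * ((H (Fin.succ i) (Fin.succ j)).1 p -
              (H (Fin.succ i) 0).1 p * (u.1 p * u.1 p) * (H 0 (Fin.succ j)).1 p) * v j = _
            ring
          have e₂ : ∀ x : ℂ, ∑ j, x * (H 0 (Fin.succ j)).1 p * v j = x * b := fun x => by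
            rw [hb, Finset.mul_sum]
            exact Finset.sum_congr rfl fun j _ => mul_assoc _ _ _
          rw [e₁]
          simp only [Fin.sum_univ_succ, Fin.cons_zero, Fin.cons_succ, Finset.sum_add_distrib, e₂,
            ← Finset.sum_mul, ← hb', star_neg, star_mul, hup']
          linear_combination (-(star b * u.1 p * u.1 p * b)) * hup p }
    refine ⟨Fin.cons (fun j => u * H 0 j) fun k => Fin.cons 0 (l k), fun i j => ?_⟩
    have hS : ∀ a b : smoothFunctions d M, star (u * a) * (u * b) = star a * (u * u) * b :=
      fun a b => by rw [star_mul, hu]; ring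
    rw [Fin.sum_univ_succ]
    simp only [Fin.cons_zero, Fin.cons_succ, hS, hH.star_apply]
    refine Fin.cases ?_ (fun i => ?_) i
    · simp only [Fin.cons_zero, star_zero, zero_mul, Finset.sum_const_zero, add_zero]
      linear_combination (-(H 0 j)) * huH
    · refine Fin.cases ?_ (fun j => ?_) j
      · simp only [Fin.cons_zero, mul_zero, Finset.sum_const_zero, add_zero]
        linear_combination (-(H i.succ 0)) * huH
      · simp only [Fin.cons_succ, ← hl]
        ring

end SmoothFunctions

end

noncomputable section

/-! ### Parseval frames -/

section Parseval

variable {A : Type*} [CommRing A] [Algebra ℂ A] [StarRing A]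
  {E : Type*} [AddCommGroup E] [Module ℂ E] [Module A E] {h₀ : E →ₗ⋆[ℂ] E →ₗ[ℂ] A}

namespace IsInnerProduct

theorem smul_left (h : IsInnerProduct h₀) (a : A) (x y : E) : h₀ (a • x) y = star a * h₀ x y := by
  rw [← h.star_apply, h.smul_right, star_mul, h.star_apply, mul_comm]

/-- The linear map `h₀ x`. -/
def toLinearMap (h : IsInnerProduct h₀) (x : E) : E →ₗ[A] A where
  toFun y := h₀ x y
  map_add' := map_add _
  map_smul' a y := h.smul_right x a y

/-- Dual families are turned into a Parseval frame by a Cholesky decomposition. -/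
theorem exists_parseval (h : IsInnerProduct h₀) {n : ℕ} {s t : Fin n → E}
    (hst : ∀ x, ∑ i, h₀ (t i) x • s i = x) {l : Fin n → Fin n → A}
    (hl : ∀ i j, h₀ (s i) (s j) + ∑ k, star ((if k = i then 1 else 0) - h₀ (t k) (s i)) *
      ((if k = j then 1 else 0) - h₀ (t k) (s j)) = ∑ k, star (l k i) * l k j) :
    ∃ e : Fin n → E, ∀ x, ∑ k, h₀ (e k) x • e k = x := by
  -- Chosen so that the coordinates `h₀ (e k) x` are `l` applied to the vector of `h₀ (t i) x`.
  let e : Fin n → E := fun k => ∑ i, star (l k i) • t i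
  have he : ∀ k x, h₀ (e k) x = ∑ i, l k i * h₀ (t i) x := fun k x => by
    simp only [e, LinearMap.map_sum₂, h.smul_left, star_star]
  -- Coordinate vectors are fixed by the projection matrix `h₀ (t k) (s i)`. Hence the second
  -- summand in `hl` is invisible on them, and only the Gram matrix of `s` counts.
  have hq : ∀ k x, ∑ i, ((if k = i then 1 else 0) - h₀ (t k) (s i)) * h₀ (t i) x = 0 := fun k x => by
    have : h₀ (t k) x = ∑ i, h₀ (t i) x * h₀ (t k) (s i) := by
      conv_lhs => rw [← hst x, map_sum]
      exact Finset.sum_congr rfl fun i _ => h.smul_right _ _ _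
    simp only [sub_mul, Finset.sum_sub_distrib, ite_mul, one_mul, zero_mul, Finset.sum_ite_eq,
      Finset.mem_univ, if_true]
    rw [this, sub_eq_zero]
    exact Finset.sum_congr rfl fun i _ => mul_comm _ _
  have hsum : ∀ x y, ∑ k, star (h₀ (e k) x) * h₀ (e k) y = h₀ x y := fun x y => by
    calc ∑ k, star (h₀ (e k) x) * h₀ (e k) y
        = ∑ k, ∑ i, ∑ j, star (h₀ (t i) x) * (star (l k i) * l k j) * h₀ (t j) y := by
          refine Finset.sum_congr rfl fun k _ => ?_
          rw [he, he, star_sum, Finset.sum_mul_sum]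
          refine Finset.sum_congr rfl fun i _ => Finset.sum_congr rfl fun j _ => ?_
          rw [star_mul]; ring
      _ = ∑ i, ∑ j, star (h₀ (t i) x) * (∑ k, star (l k i) * l k j) * h₀ (t j) y := by
          rw [Finset.sum_comm]
          refine Finset.sum_congr rfl fun i _ => ?_
          rw [Finset.sum_comm]
          refine Finset.sum_congr rfl fun j _ => ?_
          rw [Finset.mul_sum, Finset.sum_mul]
      _ = (∑ i, ∑ j, star (h₀ (t i) x) * h₀ (s i) (s j) * h₀ (t j) y) +
          ∑ k, star (∑ i, ((if k = i then 1 else 0) - h₀ (t k) (s i)) * h₀ (t i) x) *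
            ∑ j, ((if k = j then 1 else 0) - h₀ (t k) (s j)) * h₀ (t j) y := by
          have : ∀ k, star (∑ i, ((if k = i then 1 else 0) - h₀ (t k) (s i)) * h₀ (t i) x) *
              (∑ j, ((if k = j then 1 else 0) - h₀ (t k) (s j)) * h₀ (t j) y) =
              ∑ i, ∑ j, star (h₀ (t i) x) * (star ((if k = i then 1 else 0) - h₀ (t k) (s i)) *
                ((if k = j then 1 else 0) - h₀ (t k) (s j))) * h₀ (t j) y := fun k => by
            rw [star_sum, Finset.sum_mul_sum]
            refine Finset.sum_congr rfl fun i _ => Finset.sum_congr rfl fun j _ => ?_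
            rw [star_mul]; ring
          simp only [this]
          rw [Finset.sum_comm (s := Finset.univ) (t := Finset.univ)
            (f := fun k i => ∑ j, star (h₀ (t i) x) *
              (star ((if k = i then 1 else 0) - h₀ (t k) (s i)) *
                ((if k = j then 1 else 0) - h₀ (t k) (s j))) * h₀ (t j) y),
            ← Finset.sum_add_distrib]
          refine Finset.sum_congr rfl fun i _ => ?_
          rw [Finset.sum_comm, ← Finset.sum_add_distrib]
          refine Finset.sum_congr rfl fun j _ => ?_
          rw [← hl, ← Finset.sum_mul, ← Finset.mul_sum]
          ring
      _ = h₀ (∑ i, h₀ (t i) x • s i) (∑ j, h₀ (t j) y • s j) := by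
          simp only [hq, mul_zero, Finset.sum_const_zero, add_zero]
          rw [LinearMap.map_sum₂]
          refine Finset.sum_congr rfl fun i _ => ?_
          rw [map_sum]
          refine Finset.sum_congr rfl fun j _ => ?_
          rw [h.smul_left, h.smul_right]; ring
      _ = h₀ x y := by rw [hst, hst]
  refine ⟨e, fun y => ?_⟩
  -- Parseval's identity makes the reconstruction error orthogonal to everything, in particular to
  -- itself.
  have key : ∀ x, h₀ x (∑ k, h₀ (e k) y • e k - y) = 0 := fun x => by
    rw [map_sub, map_sum, sub_eq_zero, ← hsum x y]
    refine Finset.sum_congr rfl fun k _ => ?_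
    rw [h.smul_right, h.star_apply, mul_comm]
  exact sub_eq_zero.1 (h.definite _ (key _))

end IsInnerProduct

end Parseval

/-! ### Existence of Hermitian fiber metrics -/

section Metric

variable {d : ℕ} {M : Type*} [TopologicalSpace M] [ChartedSpace (EuclideanSpace ℝ (Fin d)) M]
  {F : Type*} [NormedAddCommGroup F] [NormedSpace ℂ F]
  {V : M → Type*} [TopologicalSpace (TotalSpace F V)] [∀ p, AddCommGroup (V p)]
  [∀ p, Module ℂ (V p)] [∀ p, TopologicalSpace (V p)] [FiberBundle F V] [VectorBundle ℂ F V]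

/-- The positive semidefinite form `⟨v, w⟩ ↦ conj (α v) * α w`. -/
def conjMulForm {W : Type*} [AddCommGroup W] [Module ℂ W] (α : W →ₗ[ℂ] ℂ) :
    W →ₗ⋆[ℂ] W →ₗ[ℂ] ℂ :=
  LinearMap.mk₂'ₛₗ (starRingEnd ℂ) (RingHom.id ℂ) (fun v w => star (α v) * α w)
    (fun v v' w => by rw [map_add, star_add, add_mul])
    (fun c v w => by rw [map_smul, smul_eq_mul, star_mul']; exact mul_assoc _ _ _)
    (fun v w w' => by rw [map_add, mul_add])
    (fun c v w => by rw [map_smul, smul_eq_mul, RingHom.id_apply, smul_eq_mul]; ring)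

theorem conjMulForm_apply {W : Type*} [AddCommGroup W] [Module ℂ W] (α : W →ₗ[ℂ] ℂ) (v w : W) :
    conjMulForm α v w = star (α v) * α w := rfl

/-- Standard forms of the local trivializations are averaged with a partition of unity. At each
point every term is positive semidefinite, and one with positive weight is definite. -/
theorem exists_hermitianMetric [T2Space M] [SecondCountableTopology M] [IsManifold (𝓡 d) ∞ M]
    [ContMDiffVectorBundle ∞ F V (𝓡 d)] [FiniteDimensional ℂ F] :
    Nonempty (HermitianMetric d F V) := by
  have : LocallyCompactSpace M := ChartedSpace.locallyCompactSpace (EuclideanSpace ℝ (Fin d)) M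
  obtain ⟨ρ, hρ⟩ := SmoothPartitionOfUnity.exists_isSubordinate (𝓡 d) (isClosed_univ (X := M))
    (fun q : M => (trivializationAt F V q).baseSet)
    (fun q => (trivializationAt F V q).open_baseSet)
    (fun q _ => Set.mem_iUnion.2 ⟨q, mem_baseSet_trivializationAt F V q⟩)
  let b := Module.finBasis ℂ F
  let α : M → Fin (Module.finrank ℂ F) → ∀ p, V p →ₗ[ℂ] ℂ := fun c j p =>
    b.coord j ∘ₗ (trivializationAt F V c).linearMapAt ℂ p
  have hα : ∀ c j p (_ : p ∈ (trivializationAt F V c).baseSet) v,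
      α c j p v = b.coord j (trivializationAt F V c ⟨p, v⟩).2 := fun c j p hp v => by
    simp only [α, LinearMap.comp_apply]
    rw [Trivialization.coe_linearMapAt_of_mem _ hp]
  let form : ∀ p, V p →ₗ⋆[ℂ] V p →ₗ[ℂ] ℂ := fun p =>
    ∑ c ∈ ρ.finsupport p, ((ρ c p : ℝ) : ℂ) • ∑ j, conjMulForm (α c j p)
  have hform : ∀ p v w, form p v w =
      ∑ c ∈ ρ.finsupport p, ρ c p • ∑ j, star (α c j p v) * α c j p w := fun p v w => by
    simp only [form, LinearMap.sum_apply, LinearMap.smul_apply, conjMulForm_apply,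
      Complex.real_smul, smul_eq_mul]
  refine ⟨⟨form, fun p v w => ?_, fun p v hv => ?_, fun s t => ?_⟩⟩
  · simp only [hform, star_sum, Complex.real_smul, star_mul', star_star]
    refine Finset.sum_congr rfl fun c _ => congrArg₂ _ (Complex.conj_ofReal _) ?_
    exact Finset.sum_congr rfl fun j _ => mul_comm _ _
  · have hre : (form p v v).re = ∑ c ∈ ρ.finsupport p, ρ c p * ∑ j, Complex.normSq (α c j p v) := by
      rw [hform, Complex.re_sum]
      refine Finset.sum_congr rfl fun c _ => ?_
      rw [Complex.real_smul, Complex.re_ofReal_mul, Complex.re_sum]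
      refine congrArg _ (Finset.sum_congr rfl fun j _ => ?_)
      rw [mul_comm]
      exact congrArg Complex.re (Complex.mul_conj _)
    rw [hre]
    obtain ⟨c, hc⟩ := ρ.exists_pos_of_mem (Set.mem_univ p)
    have hp : p ∈ (trivializationAt F V c).baseSet := hρ c (subset_tsupport _ hc.ne')
    refine Finset.sum_pos' (fun c _ => mul_nonneg (ρ.nonneg c p)
      (Finset.sum_nonneg fun j _ => Complex.normSq_nonneg _))
      ⟨c, (ρ.mem_finsupport p).2 hc.ne', mul_pos hc ?_⟩
    have hne : (trivializationAt F V c).linearEquivAt ℂ p hp v ≠ 0 :=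
      fun h => hv ((LinearEquiv.map_eq_zero_iff _).1 h)
    obtain ⟨j, hj⟩ : ∃ j, b.coord j ((trivializationAt F V c).linearEquivAt ℂ p hp v) ≠ 0 := by
      by_contra! h
      exact hne (b.ext_elem fun j => by simpa using h j)
    refine Finset.sum_pos' (fun j _ => Complex.normSq_nonneg _)
      ⟨j, Finset.mem_univ j, Complex.normSq_pos.2 ?_⟩
    rw [hα c j p hp]
    exact hj
  -- The finite index set depends on the point, so smoothness is read off from the locally finite
  -- sum over all indices.
  · have : (fun p => form p (s.1 p) (t.1 p)) = fun p => ∑ᶠ c, ρ c p •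
        ∑ j, star (α c j p (s.1 p)) * α c j p (t.1 p) := by
      ext p
      rw [hform, ← ρ.sum_finsupport_smul_eq_finsum
        (φ := fun c p => ∑ j, star (α c j p (s.1 p)) * α c j p (t.1 p))]
    rw [this]
    refine ρ.contMDiff_finsum_smul fun c p hp => ?_
    have hs : ∀ (s : smoothSections d F V) j,
        ContMDiffAt (𝓡 d) 𝓘(ℝ, ℂ) ∞ (fun p => α c j p (s.1 p)) p := fun s j => by
      have h₁ : ContMDiffOn (𝓡 d) 𝓘(ℝ, F) ∞ (fun p => (trivializationAt F V c ⟨p, s.1 p⟩).2)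
          (trivializationAt F V c).baseSet :=
        ((trivializationAt F V c).contMDiffOn_section_baseSet_iff).1 s.2.contMDiffOn
      have hnhds := (trivializationAt F V c).open_baseSet.mem_nhds (hρ c hp)
      have h₂ := (((b.coord j).toContinuousLinearMap.restrictScalars ℝ).contMDiff
        (n := ∞)).contMDiffAt.comp p (h₁.contMDiffAt hnhds)
      refine h₂.congr_of_eventuallyEq ?_
      filter_upwards [hnhds] with q hq
      exact hα c j q hq _
    refine contMDiffAt_finsetSum fun j _ => ?_
    exact ((contDiff_mul (𝕜 := ℝ) (𝔸 := ℂ)).contMDiff.contMDiffAt.comp p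
      (((Complex.conjCLE : ℂ →L[ℝ] ℂ).contMDiff.contMDiffAt.comp p (hs s j)).prodMk_space (hs t j)))

namespace HermitianMetric

variable (g : HermitianMetric d F V)

theorem onSections_apply (s t : smoothSections d F V) (p : M) :
    (g.onSections s t).1 p = g.form p (s.1 p) (t.1 p) := rfl

theorem form_self_eq_zero {p : M} {v : V p} (h : g.form p v v = 0) : v = 0 := by
  by_contra hv
  have := g.pos p v hv
  rw [h] at this
  simp at this

theorem isInnerProduct : IsInnerProduct g.onSections where
  star_apply s t := Subtype.ext (funext fun p => g.conj_symm p (s.1 p) (t.1 p))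
  smul_right s a t := Subtype.ext (funext fun p => map_smul (g.form p (s.1 p)) (a.1 p) (t.1 p))
  definite _ h := Subtype.ext (funext fun p =>
    g.form_self_eq_zero (congrFun (congrArg Subtype.val h) p))

end HermitianMetric

end Metric

end

noncomputable section

/-! ### Parseval frames of smooth sections -/

section Frame

variable {d : ℕ} {M : Type*} [TopologicalSpace M] [ChartedSpace (EuclideanSpace ℝ (Fin d)) M]
  {F : Type*} [NormedAddCommGroup F] [NormedSpace ℂ F]
  {V : M → Type*} [TopologicalSpace (TotalSpace F V)] [∀ p, AddCommGroup (V p)]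
  [∀ p, Module ℂ (V p)] [∀ p, TopologicalSpace (V p)] [FiberBundle F V] [VectorBundle ℂ F V]

theorem smoothSections_sum_apply {ι : Type*} (s : Finset ι) (x : ι → smoothSections d F V) (p : M) :
    (∑ i ∈ s, x i).1 p = ∑ i ∈ s, (x i).1 p := by
  rw [← Finset.sum_apply]
  exact congrFun (map_sum (smoothSections d F V).subtype x s) p

variable (F V) in
/-- The fibers of a vector bundle are linearly equivalent to the model fiber. -/
def fiberLinearEquiv (p : M) : V p ≃ₗ[ℂ] F :=
  (trivializationAt F V p).linearEquivAt ℂ p (mem_baseSet_trivializationAt F V p)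

namespace HermitianMetric

variable (g : HermitianMetric d F V)

/-- A family of sections spanning the fibers admits dual families. -/
theorem exists_dual [FiniteDimensional ℂ F] {m : ℕ} {s : Fin m → smoothSections d F V}
    (hs : SpansFibers s) :
    ∃ (n : ℕ) (s' t : Fin n → smoothSections d F V),
      ∀ x, ∑ i, g.onSections (t i) x • s' i = x := by
  let r := Module.finrank ℂ F
  have hfin : ∀ p, FiniteDimensional ℂ (V p) := fun p =>
    (fiberLinearEquiv F V p).symm.finiteDimensional
  have hr : ∀ p, Module.finrank ℂ (V p) = r := fun p => (fiberLinearEquiv F V p).finrank_eq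
  -- No single `r`-tuple need be a basis everywhere, so all tuples `f` are used, each weighted by
  -- its Gram determinant.
  let G : (Fin r → Fin m) → Matrix (Fin r) (Fin r) (smoothFunctions d M) := fun f =>
    gramMatrix (fun x y => g.onSections x y) (s ∘ f)
  let Gp : ∀ p, (Fin r → Fin m) → Matrix (Fin r) (Fin r) ℂ := fun p f =>
    gramMatrix (fun v w => g.form p v w) ((fun i => (s i).1 p) ∘ f)
  have hG : ∀ p f, (smoothEval p).mapMatrix (G f) = Gp p f := fun p f => by
    ext a b
    rfl
  have hdet : ∀ p f, (G f).det.1 p = (Gp p f).det := fun p f => by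
    rw [← hG, ← RingHom.map_det]; rfl
  have hadj : ∀ p f a b, ((G f).adjugate a b).1 p = (Gp p f).adjugate a b := fun p f a b => by
    rw [← hG, ← RingHom.map_adjugate]; rfl
  -- At every point some tuple is a basis, so the total weight is positive and `u * u` normalizes it
  -- to `1`.
  obtain ⟨u, hu, huD⟩ := exists_smooth_invSqrt (∑ f, star (G f).det * (G f).det)
    (by simp only [star_sum, star_mul, star_star]) (fun p => by
      rw [smoothFunctions_sum_apply, Complex.re_sum]
      have hterm : ∀ f, ((star (G f).det * (G f).det).1 p).re =
          Complex.normSq ((Gp p f).det) := fun f => by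
        rw [← hdet]
        change (star ((G f).det.1 p) * (G f).det.1 p).re = _
        rw [mul_comm]
        exact congrArg Complex.re (Complex.mul_conj _)
      obtain ⟨j, hj⟩ := exists_det_gramMatrix_ne_zero (hr p)
        (fun v => g.form_self_eq_zero (v := v)) (hs p)
      refine Finset.sum_pos' (fun f _ => ?_) ⟨j, Finset.mem_univ j, ?_⟩
      · rw [hterm]; exact Complex.normSq_nonneg _
      · rw [hterm]; exact Complex.normSq_pos.2 hj)
  let K := (Fin r → Fin m) × Fin r
  let s' : K → smoothSections d F V := fun k => s (k.1 k.2)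
  let t : K → smoothSections d F V := fun k =>
    ∑ b, star (u * u * star (G k.1).det * (G k.1).adjugate k.2 b) • s (k.1 b)
  have ht : ∀ k x, g.onSections (t k) x =
      ∑ b, u * u * star (G k.1).det * (G k.1).adjugate k.2 b * g.onSections (s (k.1 b)) x :=
    fun k x => by
      simp only [t, LinearMap.map_sum₂, g.isInnerProduct.smul_left, star_star]
  have hfun : ∀ x f, ∑ a, g.onSections (t (f, a)) x • s' (f, a) =
      (u * u * star (G f).det * (G f).det) • x := fun x f => by
    refine Subtype.ext (funext fun p => ?_)
    rw [smoothSections_sum_apply]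
    have h₁ : ∀ a, (g.onSections (t (f, a)) x • s' (f, a)).1 p =
        ((u * u * star (G f).det).1 p) • ((∑ b, (Gp p f).adjugate a b *
          g.form p ((s (f b)).1 p) (x.1 p)) • (s (f a)).1 p) := fun a => by
      change (g.onSections (t (f, a)) x).1 p • (s (f a)).1 p = _
      rw [ht, smoothFunctions_sum_apply, smul_smul, Finset.mul_sum]
      refine congrArg (· • _) (Finset.sum_congr rfl fun b _ => ?_)
      rw [← hadj, ← mul_assoc]
      rfl
    simp only [h₁]
    rw [← Finset.smul_sum]
    change _ = ((u * u * star (G f).det).1 p * (G f).det.1 p) • x.1 p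
    rw [mul_smul, hdet]
    -- Where the tuple degenerates Cramer's rule is not available, but the weight contains the
    -- conjugate determinant and vanishes too.
    by_cases h0 : (Gp p f).det = 0
    · have : (u * u * star (G f).det).1 p = 0 := by
        change (u * u).1 p * star ((G f).det.1 p) = 0
        rw [hdet, h0, star_zero, mul_zero]
      rw [this, zero_smul, zero_smul]
    · exact congrArg _ (det_gramMatrix_smul (hr p) h0 (x.1 p))
  let φ := Fintype.equivFin K
  refine ⟨_, s' ∘ φ.symm, t ∘ φ.symm, fun x => ?_⟩
  refine (φ.symm.sum_comp fun k => g.onSections (t k) x • s' k).trans ?_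
  rw [Fintype.sum_prod_type]
  simp only [hfun]
  rw [← Finset.sum_smul]
  simp only [mul_assoc (u * u)]
  rw [← Finset.mul_sum, huD, one_smul]

/-- The module of smooth sections has a Parseval frame. -/
theorem exists_parseval [T2Space M] [SecondCountableTopology M] [IsManifold (𝓡 d) ∞ M]
    [ContMDiffVectorBundle ∞ F V (𝓡 d)] [FiniteDimensional ℂ F] :
    ∃ (n : ℕ) (e : Fin n → smoothSections d F V),
      ∀ x, ∑ k, g.onSections (e k) x • e k = x := by
  obtain ⟨m, s₀, hs₀⟩ := exists_finite_spansFibers (d := d) (F := F) (V := V)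
  obtain ⟨n, s, t, hst⟩ := g.exists_dual hs₀
  -- `q` is the complement of the coordinate projection. The Gram matrix of the redundant family `s`
  -- is in general only semidefinite; adding `q* q` makes it definite without changing it on
  -- coordinate vectors.
  let q : Fin n → Fin n → smoothFunctions d M := fun k i =>
    (if k = i then 1 else 0) - g.onSections (t k) (s i)
  have hH : IsSmoothPosDef fun i j => g.onSections (s i) (s j) + ∑ k, star (q k i) * q k j :=
    { star_apply := fun i j => by
        simp only [star_add, star_sum, star_mul, star_star, g.isInnerProduct.star_apply]
      pos := fun p v hv => by
        let z : V p := ∑ j, v j • (s j).1 p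
        let c : Fin n → ℂ := fun k => ∑ j, (q k j).1 p * v j
        have hc : ∀ k, c k = v k - g.form p ((t k).1 p) z := fun k => by
          have : ∀ j, (q k j).1 p =
              (if k = j then 1 else 0) - g.form p ((t k).1 p) ((s j).1 p) := fun j => by
            change ((if k = j then 1 else 0 : smoothFunctions d M)).1 p - _ = _
            split_ifs <;> rfl
          simp only [c, this, z, map_sum, map_smul, smul_eq_mul, sub_mul, Finset.sum_sub_distrib,
            ite_mul, one_mul, zero_mul, Finset.sum_ite_eq, Finset.mem_univ, if_true]
          exact congrArg _ (Finset.sum_congr rfl fun j _ => mul_comm _ _)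
        have hsum : ∑ i, ∑ j, star (v i) *
            (g.onSections (s i) (s j) + ∑ k, star (q k i) * q k j).1 p * v j =
            g.form p z z + ∑ k, star (c k) * c k := by
          have h₁ : g.form p z z =
              ∑ i, ∑ j, star (v i) * g.form p ((s i).1 p) ((s j).1 p) * v j := by
            simp only [z, LinearMap.map_sum₂]
            refine Finset.sum_congr rfl fun i _ => ?_
            rw [map_sum]
            refine Finset.sum_congr rfl fun j _ => ?_
            rw [LinearMap.map_smulₛₗ₂, map_smul, smul_eq_mul, smul_eq_mul, mul_assoc,
              mul_comm (v j)]
            rfl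
          have h₂ : ∑ k, star (c k) * c k =
              ∑ i, ∑ j, star (v i) * (∑ k, star ((q k i).1 p) * (q k j).1 p) * v j := by
            have : ∀ k, star (c k) * c k =
                ∑ i, ∑ j, star (v i) * (star ((q k i).1 p) * (q k j).1 p) * v j := fun k => by
              simp only [c]
              rw [star_sum, Finset.sum_mul_sum]
              refine Finset.sum_congr rfl fun i _ => Finset.sum_congr rfl fun j _ => ?_
              rw [star_mul]; ring
            simp only [this]
            rw [Finset.sum_comm]
            refine Finset.sum_congr rfl fun i _ => ?_
            rw [Finset.sum_comm]
            refine Finset.sum_congr rfl fun j _ => ?_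
            rw [Finset.mul_sum, Finset.sum_mul]
          rw [h₁, h₂, ← Finset.sum_add_distrib]
          refine Finset.sum_congr rfl fun i _ => ?_
          rw [← Finset.sum_add_distrib]
          refine Finset.sum_congr rfl fun j _ => ?_
          rw [← add_mul, ← mul_add]
          refine congrArg (star (v i) * · * v j) ?_
          refine congrArg (g.form p ((s i).1 p) ((s j).1 p) + ·) ?_
          rw [smoothFunctions_sum_apply]
          rfl
        rw [hsum, Complex.add_re, Complex.re_sum]
        have hck : ∀ k, (star (c k) * c k).re = Complex.normSq (c k) := fun k => by
          rw [mul_comm]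
          exact congrArg Complex.re (Complex.mul_conj _)
        simp only [hck]
        -- The form at `v` is the squared length of `z` plus that of `c`. If `z` vanishes, then `c =
        -- v`, so one of the two terms is positive.
        by_cases hz : z = 0
        · obtain ⟨k, hk⟩ := Function.ne_iff.1 hv
          rw [hz, map_zero, Complex.zero_re, zero_add]
          refine Finset.sum_pos' (fun k _ => Complex.normSq_nonneg _)
            ⟨k, Finset.mem_univ k, Complex.normSq_pos.2 ?_⟩
          rw [hc, hz, map_zero, sub_zero]
          exact hk
        · exact add_pos_of_pos_of_nonneg (g.pos p z hz)
            (Finset.sum_nonneg fun k _ => Complex.normSq_nonneg _) }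
  obtain ⟨l, hl⟩ := hH.exists_cholesky
  exact ⟨n, g.isInnerProduct.exists_parseval hst hl⟩

end HermitianMetric

end Frame

end

noncomputable section

/-! ### Local deformations -/

theorem sectionSupport_subset_iff {M : Type*} [TopologicalSpace M] {W : M → Type*}
    [∀ p, Zero (W p)] {s : ∀ p, W p} {K : Set M} (hK : IsClosed K) :
    sectionSupport s ⊆ K ↔ ∀ p ∉ K, s p = 0 := by
  rw [sectionSupport, hK.closure_subset_iff]
  exact forall_congr' fun p => not_imp_comm

theorem isClosed_sectionSupport {M : Type*} [TopologicalSpace M] {W : M → Type*}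
    [∀ p, Zero (W p)] (s : ∀ p, W p) : IsClosed (sectionSupport s) := isClosed_closure

theorem apply_eq_zero_of_notMem_sectionSupport {M : Type*} [TopologicalSpace M] {W : M → Type*}
    [∀ p, Zero (W p)] {s : ∀ p, W p} {p : M} (hp : p ∉ sectionSupport s) : s p = 0 :=
  not_not.1 fun h => hp (subset_closure h)

/-! ### Inheritance of the type of the star product -/

section Types

variable {d : ℕ} {M : Type*} [TopologicalSpace M] [ChartedSpace (EuclideanSpace ℝ (Fin d)) M]
  {F : Type*} [NormedAddCommGroup F] [NormedSpace ℂ F] {V : M → Type*}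
  [TopologicalSpace (TotalSpace F V)] [∀ p, AddCommGroup (V p)] [∀ p, Module ℂ (V p)]
  [∀ p, TopologicalSpace (V p)] [FiberBundle F V] [VectorBundle ℂ F V]

instance isScalarTower_smoothSections :
    IsScalarTower ℂ (smoothFunctions d M) (smoothSections d F V) :=
  ⟨fun c f s => Subtype.ext (funext fun p => smul_assoc c (f.1 p) (s.1 p))⟩

variable {S : FormalDeformation ℂ (smoothFunctions d M)} {ι : Type*} [Fintype ι]
  (L : ProjectiveLift S (smoothSections d F V) ι)

/-- Operators that vanish outside of given closed sets. -/
def localOperatorClass (hS : S.HasType .isLocal)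
    (hL : ∀ k (x : smoothSections d F V) p, x.1 p = 0 → (L.a k x).1 p = 0)
    {Z : Type*} (K : Z → Set M) (hK : ∀ z, IsClosed (K z)) : OperatorClass L Z where
  memA _ T := ∀ z, ∀ p ∉ K z, (T z).1 p = 0
  memE _ T := ∀ z, ∀ p ∉ K z, (T z).1 p = 0
  zeroA _ _ _ _ := rfl
  addA := fun {_ T U} hT hU z p hp => by
    change (T z).1 p + (U z).1 p = 0
    rw [hT z p hp, hU z p hp, add_zero]
  zeroE _ _ _ _ := rfl
  addE := fun {_ T U} hT hU z p hp => by
    change (T z).1 p + (U z).1 p = 0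
    rw [hT z p hp, hU z p hp, add_zero]
  negE := fun {_ T} hT z p hp => by
    change -(T z).1 p = 0
    rw [hT z p hp, neg_zero]
  mono h _ := h
  coord k hT z p hp := hL k _ p (hT z p hp)
  smul := fun {_ T} k hT z p hp => by
    change (T z).1 p • (L.e k).1 p = 0
    rw [hT z p hp, zero_smul]
  mul_left r a hT z := (sectionSupport_subset_iff (hK z)).1
    ((hS r a _).trans (Set.inter_subset_right.trans ((sectionSupport_subset_iff (hK z)).2 (hT z))))
  mul_right r b hT z := (sectionSupport_subset_iff (hK z)).1
    ((hS r _ b).trans (Set.inter_subset_left.trans ((sectionSupport_subset_iff (hK z)).2 (hT z))))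

namespace ProjectiveLift

/-- The deformation inherits its type from the deformation of the algebra. -/
theorem hasType_deformation
    (hL : ∀ k (x : smoothSections d F V) p, x.1 p = 0 → (L.a k x).1 p = 0)
    {τ : DeformationType} (hS : S.HasType τ) : L.deformation.HasType τ := by
  cases τ with
  | isLocal =>
    intro r x f
    refine Set.subset_inter ?_ ?_
    · exact (sectionSupport_subset_iff (isClosed_sectionSupport _)).2
        ((localOperatorClass L hS hL (fun x : smoothSections d F V => sectionSupport x.1)
          fun _ => isClosed_sectionSupport _).memE_R_left
          (fun _ _ hp => apply_eq_zero_of_notMem_sectionSupport hp) r f x)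
    · exact (sectionSupport_subset_iff (isClosed_sectionSupport _)).2
        ((localOperatorClass L hS hL (fun f : smoothFunctions d M => sectionSupport f.1)
          fun _ => isClosed_sectionSupport _).memE_R_right
          (fun _ _ hp => apply_eq_zero_of_notMem_sectionSupport hp) r x f)
  | differential =>
    obtain ⟨k, b, hk, hb, hkb⟩ := S.exists_orderBound hS
    exact fun r => ⟨b r, fun f => (diffOperatorClass L _ hk hb hkb).memE_R_left
        ((isDiffOp_id _ _).mono (Nat.zero_le _)) r f,
      fun x => (diffOperatorClass L _ hk hb hkb).memE_R_right
        ((isDiffOp_id _ _).mono (Nat.zero_le _)) r x⟩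
  | vey =>
    -- For Vey type both order bounds are the identity: differential orders add exactly as powers of
    -- `λ` do.
    have h := fun r n : ℕ => le_refl (r + n)
    exact fun r => ⟨(diffOperatorClass L _ hS monotone_id h).memE_R_left (isDiffOp_id _ _) r,
      (diffOperatorClass L _ hS monotone_id h).memE_R_right (isDiffOp_id _ _) r⟩

/-- The Hermitian deformation inherits its type from the deformation of the algebra. -/
theorem hasType_hermitianDeformation (hH : S.IsHermitian)
    {h₀ : smoothSections d F V →ₗ⋆[ℂ] smoothSections d F V →ₗ[ℂ] smoothFunctions d M}
    (h₀s : IsInnerProduct h₀) (ha : ∀ k x, L.a k x = h₀ (L.e k) x)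
    (hL : ∀ k (x : smoothSections d F V) p, x.1 p = 0 → (L.a k x).1 p = 0)
    {τ : DeformationType} (hS : S.HasType τ) : (L.hermitianDeformation hH h₀s ha).HasType τ := by
  refine ⟨L.hasType_deformation hL hS, ?_⟩
  cases τ with
  | isLocal =>
    have hr : ∀ r x y, ∀ p ∉ sectionSupport y.1,
        ((L.hermitianDeformation hH h₀s ha).h r x y).1 p = 0 := fun r x =>
      (localOperatorClass L hS hL (fun x : smoothSections d F V => sectionSupport x.1)
        fun _ => isClosed_sectionSupport _).memA_h_right
        (fun _ _ hp => apply_eq_zero_of_notMem_sectionSupport hp) hH h₀s ha r x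
    intro r x y
    refine Set.subset_inter ?_ ?_
    · refine (sectionSupport_subset_iff (isClosed_sectionSupport _)).2 fun p hp => ?_
      rw [← HermitianModuleDeformation.star_h]
      exact (congrArg star (hr r y x p hp)).trans (star_zero ℂ)
    · exact (sectionSupport_subset_iff (isClosed_sectionSupport _)).2 (hr r x y)
  | differential =>
    obtain ⟨k, b, hk, hb, hkb⟩ := S.exists_orderBound hS
    refine fun r => ⟨b r, fun y => ?_, fun x => ?_⟩
    · simp only [HermitianModuleDeformation.star_h]
      exact (diffOperatorClass L _ hk hb hkb).memA_h_right
        ((isDiffOp_id _ _).mono (Nat.zero_le _)) hH h₀s ha r y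
    · exact (diffOperatorClass L _ hk hb hkb).memA_h_right
        ((isDiffOp_id _ _).mono (Nat.zero_le _)) hH h₀s ha r x
  | vey =>
    have h := fun r n : ℕ => le_refl (r + n)
    refine fun r => ⟨fun y => ?_, fun x => ?_⟩
    · simp only [HermitianModuleDeformation.star_h]
      exact (diffOperatorClass L _ hS monotone_id h).memA_h_right (isDiffOp_id _ _) hH h₀s ha r y
    · exact (diffOperatorClass L _ hS monotone_id h).memA_h_right (isDiffOp_id _ _) hH h₀s ha r x

end ProjectiveLift

end Types

end

/-! ### The main theorem -/

/-- The projection of a Parseval frame of smooth sections lifts to the deformed algebra. -/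
theorem HermitianMetric.exists_projectiveLift {d : ℕ} {M : Type*} [TopologicalSpace M] [T2Space M]
    [SecondCountableTopology M] [ChartedSpace (EuclideanSpace ℝ (Fin d)) M] [IsManifold (𝓡 d) ∞ M]
    {F : Type*} [NormedAddCommGroup F] [NormedSpace ℂ F] [FiniteDimensional ℂ F]
    {V : M → Type*} [TopologicalSpace (TotalSpace F V)] [∀ p, AddCommGroup (V p)]
    [∀ p, Module ℂ (V p)] [∀ p, TopologicalSpace (V p)] [FiberBundle F V] [VectorBundle ℂ F V]
    [ContMDiffVectorBundle ∞ F V (𝓡 d)]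
    (S : FormalDeformation ℂ (smoothFunctions d M)) (g : HermitianMetric d F V) :
    ∃ (n : ℕ) (L : ProjectiveLift S (smoothSections d F V) (Fin n)),
      (∀ k x, L.a k x = g.onSections (L.e k) x) ∧
      (∀ k (x : smoothSections d F V) p, x.1 p = 0 → (L.a k x).1 p = 0) ∧
      (S.IsHermitian → L.P.conjTranspose = L.P) := by
  obtain ⟨n, e, he⟩ := g.exists_parseval
  obtain ⟨L, hLe, hLa, hLP⟩ := _root_.exists_projectiveLift S e
    (fun k => g.isInnerProduct.toLinearMap (e k)) he
  have ha : ∀ k x, L.a k x = g.onSections (L.e k) x := fun k x => by rw [hLe, hLa]; rfl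
  refine ⟨n, L, ha, fun k x p hx => ?_, fun hS => ?_⟩
  · rw [ha, g.onSections_apply, hx, map_zero]
  · exact hLP hS fun i j => g.isInnerProduct.star_apply (e i) (e j)

theorem mainTheorem1 {d : ℕ} {M : Type*} [TopologicalSpace M] [T2Space M]
    [SecondCountableTopology M] [ChartedSpace (EuclideanSpace ℝ (Fin d)) M] [IsManifold (𝓡 d) ∞ M]
    {F : Type*} [NormedAddCommGroup F] [NormedSpace ℂ F] [FiniteDimensional ℂ F]
    {V : M → Type*} [TopologicalSpace (TotalSpace F V)] [∀ p, AddCommGroup (V p)]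
    [∀ p, Module ℂ (V p)] [∀ p, TopologicalSpace (V p)] [FiberBundle F V] [VectorBundle ℂ F V]
    [ContMDiffVectorBundle ∞ F V (𝓡 d)]
    (S : FormalDeformation ℂ (smoothFunctions d M)) :
    (Nonempty (ModuleDeformation S (smoothSections d F V)) ∧
      (∀ D D' : ModuleDeformation S (smoothSections d F V), D.Equivalent D') ∧
      ∀ τ : DeformationType, S.HasType τ →
        ∃ D : ModuleDeformation S (smoothSections d F V), D.HasType τ) ∧
    (S.IsHermitian → ∀ g : HermitianMetric d F V,
      Nonempty (HermitianModuleDeformation S g.onSections) ∧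
      (∀ D D' : HermitianModuleDeformation S g.onSections, D.Equivalent D') ∧
      ∀ τ : DeformationType, S.HasType τ →
        ∃ D : HermitianModuleDeformation S g.onSections, D.HasType τ) := by
  constructor
  -- In the first part the metric is auxiliary: it only provides a frame, and `⋆` need not be
  -- Hermitian.
  · obtain ⟨g⟩ := exists_hermitianMetric (d := d) (F := F) (V := V)
    obtain ⟨n, L, -, hL, -⟩ := g.exists_projectiveLift S
    exact ⟨⟨L.deformation⟩, L.equivalent, fun τ hτ => ⟨_, L.hasType_deformation hL hτ⟩⟩
  · intro hS g
    obtain ⟨n, L, ha, hL, hP⟩ := g.exists_projectiveLift S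
    exact ⟨⟨L.hermitianDeformation hS g.isInnerProduct ha⟩,
      L.hermitian_equivalent hS g.isInnerProduct ha (hP hS),
      fun τ hτ => ⟨_, L.hasType_hermitianDeformation hS g.isInnerProduct ha hL hτ⟩⟩
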